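/- Let $k$ be a commutative ring and $d\ge 0$ an integer. For a $k$-module $M$ let $\Gamma^d(M)=(M^{\otimes d})^{S_d}$. Let $\Gamma^dP_k$ be the $k$-linear category whose objects are the finitely generated projective $k$-modules, with $\operatorname{Hom}_{\Gamma^dP_k}(V,W)=\Gamma^d(\operatorname{Hom}_k(V,W))$ and composition induced by factorwise composition of linear maps; $V\otimes W$ and $\operatorname{Hom}_k(V,W)$ are functorial on $\Gamma^dP_k$ by the analogous factorwise operations. A strict polynomial functor of degree $d$ is a $k$-linear functor $\Gamma^dP_k\to k\text{-Mod}$; with natural transformations as morphisms these form the category $\operatorname{Rep}\Gamma^d_k$. For $X,Y$ in $\operatorname{Rep}\Gamma^d_k$ let - $X\mathbin{\underline{\otimes}}Y$ be the internal tensor product (Krause's $k$-linear Day convolution) $$(X\mathbin{\underline{\otimes}}Y)(U)=\int^{V,W}\operatorname{Hom}_{\Gamma^dP_k}(V\otimes W,U)\otimes_k X(V)\otimes_k Y(W),$$ - $\mathbb H(X,Y)$ be the internal Hom, $\mathbb H(X,Y)(U)=\operatorname{Hom}_{\operatorname{Rep}\Gamma^d_k}(X^U,Y)$ with $X^U=X(\operatorname{Hom}_k(U,-))$,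 - $\operatorname{Sch}(X)=\operatorname{Hom}_{\operatorname{Rep}\Gamma^d_k}(\otimes^d,X)$, where $\otimes^d$ is the functor $V\mapsto V^{\otimes d}$, regarded as a $kS_d$-module by $(\sigma\alpha)(t)=\alpha(\sigma^{-1}t)$, where $S_d$ acts on $V^{\otimes d}$ from the left by permuting the factors. Then there are isomorphisms of $kS_d$-modules, natural in $X$ and $Y$, $$\operatorname{Sch}(X\mathbin{\underline{\otimes}}Y)\cong\operatorname{Sch}(X)\otimes_k\operatorname{Sch}(Y)\qquad\text{and}\qquad \operatorname{Sch}(\mathbb H(X,Y))\cong\operatorname{Hom}_k(\operatorname{Sch}(X),\operatorname{Sch}(Y)),$$ where $S_d$ acts diagonally on the tensor product and by $\sigma\cdot\varphi=\sigma\circ\varphi\circ\sigma^{-1}$ on the Hom. -/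

import Mathlib

open CategoryTheory
open scoped TensorProduct

universe w u

noncomputable section

namespace SPF

/-! ## Tensor powers, place permutations and divided powers -/

section Gamma

variable {k : Type u} [CommRing k] {d : ℕ}
variable {A B C D E F : Type u} [AddCommGroup A] [Module k A] [AddCommGroup B] [Module k B]
  [AddCommGroup C] [Module k C] [AddCommGroup D] [Module k D] [AddCommGroup E] [Module k E]
  [AddCommGroup F] [Module k F]

/-- The `d`-th tensor power `M^{⊗ d}` over `k`. -/
abbrev TPow (k : Type u) [CommRing k] (d : ℕ) (M : Type u) [AddCommGroup M] [Module k M] :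
    Type u :=
  PiTensorProduct k (fun _ : Fin d => M)

theorem TPow.ind {p : TPow k d A → Prop} (h : ∀ a : Fin d → A, p (PiTensorProduct.tprod k a))
    (hadd : ∀ x y, p x → p y → p (x + y)) (hsmul : ∀ (r : k) x, p x → p (r • x))
    (x : TPow k d A) : p x :=
  PiTensorProduct.induction_on x (fun r a => hsmul r _ (h a)) hadd

/-- The left action of the symmetric group `S_d` on `M^{⊗ d}` by permutation of the factors:
`σ (m_1 ⊗ ⋯ ⊗ m_d)` has `m_{σ⁻¹ i}` in position `i`. -/
def permRep (k : Type u) [CommRing k] (d : ℕ) (M : Type u) [AddCommGroup M] [Module k M] :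
    Representation k (Equiv.Perm (Fin d)) (TPow k d M) where
  toFun σ := (PiTensorProduct.reindex k (fun _ : Fin d => M) σ).toLinearMap
  map_one' := by
    apply PiTensorProduct.ext
    ext a
    simp
    rfl
  map_mul' σ τ := by
    apply PiTensorProduct.ext
    ext a
    simp [PiTensorProduct.reindex_tprod]
    rfl

@[simp]
theorem permRep_tprod (σ : Equiv.Perm (Fin d)) (a : Fin d → A) :
    permRep k d A σ (PiTensorProduct.tprod k a) =
      PiTensorProduct.tprod k (fun i => a (σ.symm i)) :=
  PiTensorProduct.reindex_tprod σ a

/-- The divided power `Γ^d(M) = (M^{⊗ d})^{S_d}`. -/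
def Gam (k : Type u) [CommRing k] (d : ℕ) (M : Type u) [AddCommGroup M] [Module k M] :
    Submodule k (TPow k d M) :=
  (permRep k d M).invariants

/-- The element `m ⊗ ⋯ ⊗ m` of `Γ^d(M)`. -/
def Gam.pure (k : Type u) [CommRing k] (d : ℕ) {M : Type u} [AddCommGroup M] [Module k M] (m : M) :
    Gam k d M :=
  ⟨PiTensorProduct.tprod k (fun _ => m), fun σ => by simp⟩

/-- The bilinear map `A^{⊗ d} × B^{⊗ d} → C^{⊗ d}` given factorwise by the bilinear map `φ`. -/
def tmap₂ (φ : A →ₗ[k] B →ₗ[k] C) : TPow k d A →ₗ[k] TPow k d B →ₗ[k] TPow k d C :=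
  PiTensorProduct.map₂ (fun _ => φ)

@[simp]
theorem tmap₂_tprod (φ : A →ₗ[k] B →ₗ[k] C) (a : Fin d → A) (b : Fin d → B) :
    tmap₂ φ (PiTensorProduct.tprod k a) (PiTensorProduct.tprod k b) =
      PiTensorProduct.tprod k (fun i => φ (a i) (b i)) :=
  PiTensorProduct.map₂_tprod_tprod _ _ _

theorem tmap₂_perm (φ : A →ₗ[k] B →ₗ[k] C) (σ : Equiv.Perm (Fin d)) (x : TPow k d A)
    (y : TPow k d B) :
    tmap₂ φ (permRep k d A σ x) (permRep k d B σ y) = permRep k d C σ (tmap₂ φ x y) := by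
  induction x using TPow.ind with
  | h a =>
    induction y using TPow.ind with
    | h b => simp
    | hadd y y' h h' => simp only [map_add, h, h']
    | hsmul r y h => simp only [map_smul, h]
  | hadd x x' h h' => simp only [map_add, LinearMap.add_apply, h, h']
  | hsmul r x h => simp only [map_smul, LinearMap.smul_apply, h]

/-- The bilinear map `Γ^d(A) × Γ^d(B) → Γ^d(C)` induced by a bilinear map `φ : A × B → C`;
it is the restriction of the factorwise map `tmap₂ φ`. -/
def Gam.map₂ (φ : A →ₗ[k] B →ₗ[k] C) : Gam k d A →ₗ[k] Gam k d B →ₗ[k] Gam k d C :=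
  LinearMap.mk₂ k
    (fun x y => ⟨tmap₂ φ x.1 y.1, fun σ => by
      rw [← tmap₂_perm, x.2 σ, y.2 σ]⟩)
    (fun _ _ _ => Subtype.ext (by simp))
    (fun _ _ _ => Subtype.ext (by simp))
    (fun _ _ _ => Subtype.ext (by simp))
    (fun _ _ _ => Subtype.ext (by simp))

@[simp]
theorem Gam.map₂_val (φ : A →ₗ[k] B →ₗ[k] C) (x : Gam k d A) (y : Gam k d B) :
    (Gam.map₂ φ x y).1 = tmap₂ φ x.1 y.1 := rfl

theorem Gam.map₂_pure (φ : A →ₗ[k] B →ₗ[k] C) (a : A) (b : B) :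
    Gam.map₂ φ (Gam.pure k d a) (Gam.pure k d b) = Gam.pure k d (φ a b) :=
  Subtype.ext (by simp [Gam.pure])

theorem tmap₂_pure_left (φ : A →ₗ[k] B →ₗ[k] B) (a : A) (h : ∀ b, φ a b = b) (y : TPow k d B) :
    tmap₂ φ (PiTensorProduct.tprod k (fun _ => a)) y = y := by
  induction y using TPow.ind with
  | h b => simp [h]
  | hadd y y' h h' => simp only [map_add, h, h']
  | hsmul r y h => simp only [map_smul, h]

theorem tmap₂_pure_right (φ : A →ₗ[k] B →ₗ[k] A) (b : B) (h : ∀ a, φ a b = a) (x : TPow k d A) :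
    tmap₂ φ x (PiTensorProduct.tprod k (fun _ => b)) = x := by
  induction x using TPow.ind with
  | h b => simp [h]
  | hadd y y' h h' => simp only [map_add, LinearMap.add_apply, h, h']
  | hsmul r y h => simp only [map_smul, LinearMap.smul_apply, h]

theorem tmap₂_flip (φ : A →ₗ[k] B →ₗ[k] C) (x : TPow k d A) (y : TPow k d B) :
    tmap₂ φ.flip y x = tmap₂ φ x y := by
  induction x using TPow.ind with
  | h a =>
    induction y using TPow.ind with
    | h b => simp
    | hadd y y' h h' => simp only [map_add, LinearMap.add_apply, h, h']
    | hsmul r y h => simp only [map_smul, LinearMap.smul_apply, h]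
  | hadd x x' h h' => simp only [map_add, LinearMap.add_apply, h, h']
  | hsmul r x h => simp only [map_smul, LinearMap.smul_apply, h]

theorem tmap₂_assoc (φ : A →ₗ[k] B →ₗ[k] D) (ψ : D →ₗ[k] C →ₗ[k] E)
    (φ' : B →ₗ[k] C →ₗ[k] F) (ψ' : A →ₗ[k] F →ₗ[k] E)
    (h : ∀ a b c, ψ (φ a b) c = ψ' a (φ' b c))
    (x : TPow k d A) (y : TPow k d B) (z : TPow k d C) :
    tmap₂ ψ (tmap₂ φ x y) z = tmap₂ ψ' x (tmap₂ φ' y z) := by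
  induction x using TPow.ind with
  | h a =>
    induction y using TPow.ind with
    | h b =>
      induction z using TPow.ind with
      | h c => simp [h]
      | hadd z z' h h' => simp only [map_add, h, h']
      | hsmul r z h => simp only [map_smul, h]
    | hadd y y' h h' => simp only [map_add, LinearMap.add_apply, h, h']
    | hsmul r y h => simp only [map_smul, LinearMap.smul_apply, h]
  | hadd x x' h h' => simp only [map_add, LinearMap.add_apply, h, h']
  | hsmul r x h => simp only [map_smul, LinearMap.smul_apply, h]

/-- The interchange law for factorwise bilinear operations. -/
theorem tmap₂_interchange {G H K : Type u} [AddCommGroup G] [Module k G] [AddCommGroup H]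
    [Module k H] [AddCommGroup K] [Module k K]
    (α : A →ₗ[k] B →ₗ[k] E) (β : C →ₗ[k] D →ₗ[k] F) (γ : E →ₗ[k] F →ₗ[k] K)
    (α' : A →ₗ[k] C →ₗ[k] G) (β' : B →ₗ[k] D →ₗ[k] H) (γ' : G →ₗ[k] H →ₗ[k] K)
    (h : ∀ a b c e, γ (α a b) (β c e) = γ' (α' a c) (β' b e))
    (x : TPow k d A) (y : TPow k d B) (z : TPow k d C) (t : TPow k d D) :
    tmap₂ γ (tmap₂ α x y) (tmap₂ β z t) = tmap₂ γ' (tmap₂ α' x z) (tmap₂ β' y t) := by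
  induction x using TPow.ind with
  | h a =>
    induction y using TPow.ind with
    | h b =>
      induction z using TPow.ind with
      | h c =>
        induction t using TPow.ind with
        | h e => simp [h]
        | hadd z z' h h' => simp only [map_add, h, h']
        | hsmul r z h => simp only [map_smul, h]
      | hadd z z' h h' => simp only [map_add, LinearMap.add_apply, h, h']
      | hsmul r z h => simp only [map_smul, LinearMap.smul_apply, h]
    | hadd y y' h h' => simp only [map_add, LinearMap.add_apply, h, h']
    | hsmul r y h => simp only [map_smul, LinearMap.smul_apply, h]
  | hadd x x' h h' => simp only [map_add, LinearMap.add_apply, h, h']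
  | hsmul r x h => simp only [map_smul, LinearMap.smul_apply, h]

end Gamma

/-! ## The divided power category -/

/-- The objects of the divided power category `Γ^d P_k`: finitely generated projective
`k`-modules. -/
structure DivPow (k : Type u) [CommRing k] (d : ℕ) where
  /-- the underlying module -/
  carrier : Type u
  [grp : AddCommGroup carrier]
  [mod : Module k carrier]
  [fin : Module.Finite k carrier]
  [proj : Module.Projective k carrier]

attribute [instance] DivPow.grp DivPow.mod DivPow.fin DivPow.proj

namespace DivPow

variable {k : Type u} [CommRing k] {d : ℕ}

/-- Composition of linear maps (in diagrammatic order) as a bilinear map. -/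
def compL (U V W : Type u) [AddCommGroup U] [Module k U] [AddCommGroup V] [Module k V]
    [AddCommGroup W] [Module k W] : (U →ₗ[k] V) →ₗ[k] (V →ₗ[k] W) →ₗ[k] (U →ₗ[k] W) :=
  (LinearMap.llcomp k U V W).flip

@[simp]
theorem compL_apply {U V W : Type u} [AddCommGroup U] [Module k U] [AddCommGroup V] [Module k V]
    [AddCommGroup W] [Module k W] (f : U →ₗ[k] V) (g : V →ₗ[k] W) : compL U V W f g = g ∘ₗ f := rfl

/-- The divided power category: a morphism `V ⟶ W` is an element of `Γ^d(Hom_k(V, W))`, and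
composition is the factorwise composition of `d`-fold tensors of linear maps. -/
instance : Category.{u} (DivPow k d) where
  Hom V W := Gam k d (V.carrier →ₗ[k] W.carrier)
  id V := Gam.pure k d LinearMap.id
  comp {U V W} f g := Gam.map₂ (compL U.carrier V.carrier W.carrier) f g
  id_comp f := Subtype.ext (tmap₂_pure_left _ _ (fun _ => rfl) _)
  comp_id f := Subtype.ext (tmap₂_pure_right _ _ (fun _ => rfl) _)
  assoc f g h := Subtype.ext (tmap₂_assoc _ _ _ _ (fun _ _ _ => rfl) _ _ _)

instance (V W : DivPow k d) : AddCommGroup (V ⟶ W) :=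
  inferInstanceAs (AddCommGroup (Gam k d (V.carrier →ₗ[k] W.carrier)))

instance (V W : DivPow k d) : Module k (V ⟶ W) :=
  inferInstanceAs (Module k (Gam k d (V.carrier →ₗ[k] W.carrier)))

theorem comp_val {U V W : DivPow k d} (f : U ⟶ V) (g : V ⟶ W) :
    (f ≫ g).1 = tmap₂ (compL U.carrier V.carrier W.carrier) f.1 g.1 := rfl

theorem add_val {U V : DivPow k d} (f g : U ⟶ V) : (f + g).1 = f.1 + g.1 := rfl

theorem smul_val {U V : DivPow k d} (r : k) (f : U ⟶ V) : (r • f).1 = r • f.1 := rfl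

instance : Preadditive (DivPow k d) where
  add_comp _ _ _ f f' g := Subtype.ext (by
    simp only [add_val, comp_val, map_add, LinearMap.add_apply])
  comp_add _ _ _ f g g' := Subtype.ext (by
    simp only [add_val, comp_val, map_add])

instance : Linear k (DivPow k d) where
  smul_comp _ _ _ r f g := Subtype.ext (by
    simp only [smul_val, comp_val, map_smul, LinearMap.smul_apply])
  comp_smul _ _ _ f r g := Subtype.ext (by
    simp only [smul_val, comp_val, map_smul])

/-- The tensor product of objects of `Γ^d P_k`. -/
def tens (V W : DivPow k d) : DivPow k d := ⟨V.carrier ⊗[k] W.carrier⟩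

/-- The tensor product of linear maps as a bilinear map. -/
def tensL (V V' W W' : Type u) [AddCommGroup V] [Module k V] [AddCommGroup V'] [Module k V']
    [AddCommGroup W] [Module k W] [AddCommGroup W'] [Module k W'] :
    (V →ₗ[k] V') →ₗ[k] (W →ₗ[k] W') →ₗ[k] (V ⊗[k] W →ₗ[k] V' ⊗[k] W') :=
  LinearMap.mk₂ k TensorProduct.map TensorProduct.map_add_left TensorProduct.map_smul_left
    TensorProduct.map_add_right TensorProduct.map_smul_right

@[simp]
theorem tensL_apply {V V' W W' : Type u} [AddCommGroup V] [Module k V] [AddCommGroup V']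
    [Module k V'] [AddCommGroup W] [Module k W] [AddCommGroup W'] [Module k W']
    (f : V →ₗ[k] V') (g : W →ₗ[k] W') : tensL V V' W W' f g = TensorProduct.map f g := rfl

/-- The tensor product of morphisms of `Γ^d P_k`, given factorwise by the tensor product of
linear maps. -/
def tensHom {V V' W W' : DivPow k d} (f : V ⟶ V') (g : W ⟶ W') : tens V W ⟶ tens V' W' :=
  Gam.map₂ (tensL V.carrier V'.carrier W.carrier W'.carrier) f g

theorem tensHom_id (V W : DivPow k d) : tensHom (𝟙 V) (𝟙 W) = 𝟙 (tens V W) :=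
  (Gam.map₂_pure _ _ _).trans (congrArg (Gam.pure k d) TensorProduct.map_id)

theorem tensHom_comp {V V' V'' W W' W'' : DivPow k d} (f : V ⟶ V') (f' : V' ⟶ V'') (g : W ⟶ W')
    (g' : W' ⟶ W'') : tensHom (f ≫ f') (g ≫ g') = tensHom f g ≫ tensHom f' g' :=
  Subtype.ext (tmap₂_interchange _ _ _ _ _ _
    (fun a b c e => TensorProduct.map_comp b e a c) _ _ _ _)

section HomObject

variable (V W : Type u) [AddCommGroup V] [Module k V] [AddCommGroup W] [Module k W]
  [Module.Finite k V] [Module.Projective k V]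

theorem exists_retract_hom : ∃ (n : ℕ) (i : (V →ₗ[k] W) →ₗ[k] (Fin n → W))
    (p : (Fin n → W) →ₗ[k] (V →ₗ[k] W)), p ∘ₗ i = LinearMap.id := by
  obtain ⟨n, q, s, -, -, hqs⟩ := Module.Finite.exists_comp_eq_id_of_projective k V
  let b := (Pi.basisFun k (Fin n)).constr (M' := W) k
  refine ⟨n, b.symm.toLinearMap ∘ₗ LinearMap.lcomp k W q,
    LinearMap.lcomp k W s ∘ₗ b.toLinearMap, ?_⟩
  ext f v
  simpa using congrArg f (LinearMap.congr_fun hqs v)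

theorem finite_hom [Module.Finite k W] : Module.Finite k (V →ₗ[k] W) := by
  obtain ⟨n, i, p, h⟩ := exists_retract_hom (k := k) V W
  exact Module.Finite.of_surjective p fun x => ⟨i x, LinearMap.congr_fun h x⟩

theorem projective_hom [Module.Projective k W] : Module.Projective k (V →ₗ[k] W) := by
  obtain ⟨n, i, p, h⟩ := exists_retract_hom (k := k) V W
  have : Module.Projective k (Fin n → W) :=
    Module.Projective.of_equiv (DirectSum.linearEquivFunOnFintype k (Fin n) (fun _ => W))
  exact Module.Projective.of_split i p h

end HomObject

/-- The object `Hom_k(V, W)` of `Γ^d P_k`. -/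
def ihom (V W : DivPow k d) : DivPow k d :=
  haveI := finite_hom (k := k) V.carrier W.carrier
  haveI := projective_hom (k := k) V.carrier W.carrier
  ⟨V.carrier →ₗ[k] W.carrier⟩

/-- The bilinear map sending `f : V' → V` and `g : W → W'` to the map
`Hom_k(V, W) → Hom_k(V', W')`, `h ↦ g ∘ h ∘ f`. -/
def ihomL (V V' W W' : Type u) [AddCommGroup V] [Module k V] [AddCommGroup V'] [Module k V']
    [AddCommGroup W] [Module k W] [AddCommGroup W'] [Module k W'] :
    (V' →ₗ[k] V) →ₗ[k] (W →ₗ[k] W') →ₗ[k] ((V →ₗ[k] W) →ₗ[k] (V' →ₗ[k] W')) :=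
  LinearMap.mk₂ k (fun f g => LinearMap.llcomp k V' W W' g ∘ₗ LinearMap.lcomp k W f)
    (fun _ _ _ => by ext; simp) (fun _ _ _ => by ext; simp)
    (fun _ _ _ => by ext; simp) (fun _ _ _ => by ext; simp)

@[simp]
theorem ihomL_apply {V V' W W' : Type u} [AddCommGroup V] [Module k V] [AddCommGroup V']
    [Module k V'] [AddCommGroup W] [Module k W] [AddCommGroup W'] [Module k W']
    (f : V' →ₗ[k] V) (g : W →ₗ[k] W') (h : V →ₗ[k] W) : ihomL V V' W W' f g h = g ∘ₗ h ∘ₗ f := rfl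

/-- The action of `Hom_k(-, -)` on morphisms of `Γ^d P_k`. -/
def ihomHom {V V' W W' : DivPow k d} (f : V' ⟶ V) (g : W ⟶ W') : ihom V W ⟶ ihom V' W' :=
  Gam.map₂ (ihomL V.carrier V'.carrier W.carrier W'.carrier) f g

theorem ihomHom_comp {V V' V'' W W' W'' : DivPow k d} (f : V' ⟶ V) (f' : V'' ⟶ V') (g : W ⟶ W')
    (g' : W' ⟶ W'') : ihomHom (f' ≫ f) (g ≫ g') = ihomHom f g ≫ ihomHom f' g' :=
  Subtype.ext ((congrArg (fun z => tmap₂ _ z _) (tmap₂_flip _ _ _)).symm.trans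
    (tmap₂_interchange (compL V''.carrier V'.carrier V.carrier).flip
      (compL W.carrier W'.carrier W''.carrier)
      (ihomL V.carrier V''.carrier W.carrier W''.carrier)
      (ihomL V.carrier V'.carrier W.carrier W'.carrier)
      (ihomL V'.carrier V''.carrier W'.carrier W''.carrier)
      (compL _ _ _) (fun _ _ _ _ => rfl) f.1 f'.1 g.1 g'.1))

theorem ihomHom_id (V W : DivPow k d) : ihomHom (𝟙 V) (𝟙 W) = 𝟙 (ihom V W) :=
  (Gam.map₂_pure _ _ _).trans (congrArg (Gam.pure k d) rfl)

theorem ihomHom_add {V V' W W' : DivPow k d} (f f' : V' ⟶ V) (g : W ⟶ W') :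
    ihomHom (f + f') g = ihomHom f g + ihomHom f' g :=
  Subtype.ext (by
    change tmap₂ _ _ _ = tmap₂ _ _ _ + tmap₂ _ _ _
    rw [add_val, map_add]
    rfl)

theorem ihomHom_smul {V V' W W' : DivPow k d} (r : k) (f : V' ⟶ V) (g : W ⟶ W') :
    ihomHom (r • f) g = r • ihomHom f g :=
  Subtype.ext (by
    change tmap₂ _ _ _ = r • tmap₂ _ _ _
    rw [smul_val, map_smul]
    rfl)

/-- The functor `Hom_k(U, -)` on `Γ^d P_k`. -/
def ihomFunctor (U : DivPow k d) : DivPow k d ⥤ DivPow k d where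
  obj V := ihom U V
  map g := ihomHom (𝟙 U) g
  map_id V := ihomHom_id U V
  map_comp g g' := by
    rw [← ihomHom_comp, Category.comp_id]

instance (U : DivPow k d) : (ihomFunctor U).Additive where
  map_add {_ _ f g} := Subtype.ext (by
    change tmap₂ _ _ _ = tmap₂ _ _ _ + tmap₂ _ _ _
    rw [add_val, map_add]
    rfl)

instance (U : DivPow k d) : (ihomFunctor U).Linear k where
  map_smul f r := Subtype.ext (by
    change tmap₂ _ _ _ = r • tmap₂ _ _ _
    rw [smul_val, map_smul]
    rfl)

/-- A morphism `f : U ⟶ U'` induces a natural transformation `Hom_k(U', -) ⟶ Hom_k(U, -)`. -/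
def ihomNat {U U' : DivPow k d} (f : U ⟶ U') : ihomFunctor U' ⟶ ihomFunctor U where
  app V := ihomHom f (𝟙 V)
  naturality V W g := by
    change ihomHom _ _ ≫ ihomHom _ _ = ihomHom _ _ ≫ ihomHom _ _
    rw [← ihomHom_comp, ← ihomHom_comp]
    simp

/-- The linear map `V^{⊗ d} → W^{⊗ d}` defined by an element of `Γ^d(Hom_k(V, W))`: the
factorwise evaluation of a tensor of linear maps on a tensor of vectors. -/
def evalL (V W : DivPow k d) :
    (V ⟶ W) →ₗ[k] (TPow k d V.carrier →ₗ[k] TPow k d W.carrier) :=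
  tmap₂ LinearMap.id ∘ₗ (Gam k d (V.carrier →ₗ[k] W.carrier)).subtype

theorem evalL_apply {V W : DivPow k d} (f : V ⟶ W) (t : TPow k d V.carrier) :
    evalL V W f t = tmap₂ LinearMap.id f.1 t := rfl

theorem evalL_perm {V W : DivPow k d} (f : V ⟶ W) (σ : Equiv.Perm (Fin d))
    (t : TPow k d V.carrier) :
    evalL V W f (permRep k d V.carrier σ t) = permRep k d W.carrier σ (evalL V W f t) := by
  rw [evalL_apply, evalL_apply, ← tmap₂_perm, f.2 σ]

theorem evalL_id (V : DivPow k d) (t : TPow k d V.carrier) : evalL V V (𝟙 V) t = t := by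
  exact tmap₂_pure_left _ _ (fun _ => rfl) t

theorem evalL_comp {U V W : DivPow k d} (f : U ⟶ V) (g : V ⟶ W) (t : TPow k d U.carrier) :
    evalL U W (f ≫ g) t = evalL V W g (evalL U V f t) := by
  simp only [evalL_apply, comp_val]
  rw [← tmap₂_flip (compL _ _ _)]
  exact tmap₂_assoc _ _ _ _ (fun _ _ _ => rfl) _ _ _

end DivPow

/-! ## Strict polynomial functors -/

/-- The property of being a `k`-linear functor `Γ^d P_k ⥤ k-Mod`. -/
def IsStrictPoly (k : Type u) [CommRing k] (d : ℕ) :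
    ObjectProperty (DivPow k d ⥤ ModuleCat.{max w (u + 1)} k) :=
  fun F => F.Additive ∧ F.Linear k

/-- The category `Rep Γ^d_k` of strict polynomial functors of degree `d`: the `k`-linear functors
from `Γ^d P_k` to `k`-modules, with natural transformations as morphisms. The modules live in any
universe large enough for `P_k` to be a small category. -/
abbrev StrictPoly (k : Type u) [CommRing k] (d : ℕ) :=
  (IsStrictPoly.{w, u} k d).FullSubcategory

namespace StrictPoly

variable {k : Type u} [CommRing k] {d : ℕ}

instance (X : StrictPoly.{w, u} k d) : X.obj.Additive := X.property.1

instance (X : StrictPoly.{w, u} k d) : X.obj.Linear k := X.property.2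

/-- The functor `V ↦ V^{⊗ d}` with values in small modules. -/
def tensorPowerFunctor (k : Type u) [CommRing k] (d : ℕ) : DivPow k d ⥤ ModuleCat.{u} k where
  obj V := ModuleCat.of k (TPow k d V.carrier)
  map {V W} f := ModuleCat.ofHom (DivPow.evalL V W f)
  map_id V := by
    ext1
    exact LinearMap.ext (DivPow.evalL_id V)
  map_comp f g := by
    ext1
    exact LinearMap.ext (DivPow.evalL_comp f g)

instance : (tensorPowerFunctor k d).Additive where
  map_add {V W f g} := by
    ext1
    exact map_add (DivPow.evalL V W) f g

instance : (tensorPowerFunctor k d).Linear k where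
  map_smul {V W} f r := by
    ext1
    exact map_smul (DivPow.evalL V W) r f

/-- The strict polynomial functor `⊗^d : V ↦ V^{⊗ d}`. -/
def tensorPower (k : Type u) [CommRing k] (d : ℕ) : StrictPoly.{w, u} k d :=
  ⟨tensorPowerFunctor k d ⋙ ModuleCat.uliftFunctor.{max w (u + 1), u} k,
    ⟨inferInstance, inferInstance⟩⟩

/-- The endomorphism of `⊗^d` given by the place permutation `σ` on each `V^{⊗ d}`. -/
def permEnd (σ : Equiv.Perm (Fin d)) : tensorPower.{w, u} k d ⟶ tensorPower.{w, u} k d :=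
  ObjectProperty.homMk (Functor.whiskerRight
    { app := fun V => ModuleCat.ofHom (permRep k d V.carrier σ)
      naturality := fun V W f => by
        ext t
        exact (DivPow.evalL_perm f σ t).symm }
    (ModuleCat.uliftFunctor.{max w (u + 1), u} k))

theorem permEnd_one : permEnd.{w, u} (1 : Equiv.Perm (Fin d)) = 𝟙 (tensorPower.{w, u} k d) := by
  ext V t
  exact congrArg ULift.up
    (LinearMap.congr_fun (map_one (permRep k d V.carrier)) (ULift.down t))

theorem permEnd_mul (σ τ : Equiv.Perm (Fin d)) :
    permEnd.{w, u} (k := k) (σ * τ) = permEnd τ ≫ permEnd σ := by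
  ext V t
  exact congrArg ULift.up
    (LinearMap.congr_fun (map_mul (permRep k d V.carrier) σ τ) (ULift.down t))

/-! ### The Schur functor -/

/-- The representation of `S_d` on `Hom(⊗^d, X)`: the left action which comes from the natural
right action of `S_d` on `⊗^d`, that is `(σ • α)(t) = α(σ⁻¹ t)`. -/
def schRep (X : StrictPoly.{w, u} k d) :
    Representation k (Equiv.Perm (Fin d)) (tensorPower.{w, u} k d ⟶ X) where
  toFun σ := Linear.leftComp k X (permEnd σ⁻¹)
  map_one' := by
    ext1 α
    simp [permEnd_one]
  map_mul' σ τ := by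
    ext1 α
    simp [permEnd_mul]

/-- The Schur functor `Sch = Hom(⊗^d, -)` from strict polynomial functors of degree `d` to
representations of `S_d` over `k`. -/
def Sch (k : Type u) [CommRing k] (d : ℕ) :
    StrictPoly.{w, u} k d ⥤ Rep.{max w (u + 1)} k (Equiv.Perm (Fin d)) where
  obj X := Rep.of (schRep X)
  map {X Y} f := Rep.ofHom
    ⟨Linear.rightComp k (tensorPower.{w, u} k d) f, fun σ => by
      ext1 α
      exact Category.assoc (W := tensorPower.{w, u} k d) (permEnd σ⁻¹) α f⟩
  map_id X := by
    ext α : 3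
    exact Category.comp_id (Y := X) α
  map_comp {X Y Z} f g := by
    ext α : 3
    exact (Category.assoc (X := X) α f g).symm

/-! ### The internal Hom -/

/-- The parametrized functor `X^U = X(Hom_k(U, -))`. -/
def param (X : StrictPoly.{w, u} k d) (U : DivPow k d) : StrictPoly.{w, u} k d :=
  ⟨DivPow.ihomFunctor U ⋙ X.obj, ⟨inferInstance, inferInstance⟩⟩

/-- The map `X^{U'} ⟶ Y^U` induced by `f : U ⟶ U'` and `g : X ⟶ Y`. -/
def paramMap {X Y : StrictPoly.{w, u} k d} {U U' : DivPow k d} (g : X ⟶ Y) (f : U ⟶ U') :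
    param X U' ⟶ param Y U :=
  ObjectProperty.homMk (Functor.whiskerRight (DivPow.ihomNat f) X.obj ≫
    Functor.whiskerLeft (DivPow.ihomFunctor U) g.hom)

theorem paramMap_app {X Y : StrictPoly.{w, u} k d} {U U' : DivPow k d} (g : X ⟶ Y) (f : U ⟶ U')
    (V : DivPow k d) : (paramMap g f).hom.app V =
      X.obj.map (DivPow.ihomHom f (𝟙 V)) ≫ g.hom.app (DivPow.ihom U V) := rfl

theorem paramMap_id (X : StrictPoly.{w, u} k d) (U : DivPow k d) :
    paramMap (𝟙 X) (𝟙 U) = 𝟙 (param X U) := by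
  ext1
  ext1
  ext1 V
  rw [paramMap_app, DivPow.ihomHom_id]
  exact (Category.comp_id _).trans (X.obj.map_id _)

theorem paramMap_comp {X Y Z : StrictPoly.{w, u} k d} {U U' U'' : DivPow k d} (g : X ⟶ Y)
    (g' : Y ⟶ Z) (f : U ⟶ U') (f' : U' ⟶ U'') :
    paramMap (g ≫ g') (f ≫ f') = paramMap g f' ≫ paramMap g' f := by
  ext1
  ext1
  ext1 V
  change X.obj.map _ ≫ g.hom.app _ ≫ g'.hom.app _ =
    (X.obj.map _ ≫ g.hom.app _) ≫ Y.obj.map _ ≫ g'.hom.app _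
  have h : (DivPow.ihomNat (f ≫ f')).app V =
      (DivPow.ihomNat f').app V ≫ (DivPow.ihomNat f).app V := by
    change DivPow.ihomHom _ _ = DivPow.ihomHom _ _ ≫ DivPow.ihomHom _ _
    rw [← DivPow.ihomHom_comp, Category.comp_id]
  rw [h, X.obj.map_comp]
  simp only [Category.assoc, NatTrans.naturality_assoc]

theorem paramMap_add (X : StrictPoly.{w, u} k d) {U U' : DivPow k d} (f f' : U ⟶ U') :
    paramMap (𝟙 X) (f + f') = paramMap (𝟙 X) f + paramMap (𝟙 X) f' := by
  ext1
  ext1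
  ext1 V
  change X.obj.map _ ≫ 𝟙 _ = X.obj.map _ ≫ 𝟙 _ + X.obj.map _ ≫ 𝟙 _
  rw [Category.comp_id, Category.comp_id, Category.comp_id]
  have h : X.obj.map (DivPow.ihomHom (f + f') (𝟙 V)) =
      X.obj.map (DivPow.ihomHom f (𝟙 V)) + X.obj.map (DivPow.ihomHom f' (𝟙 V)) := by
    rw [DivPow.ihomHom_add, X.obj.map_add]
  exact h

theorem paramMap_smul (X : StrictPoly.{w, u} k d) {U U' : DivPow k d} (r : k) (f : U ⟶ U') :
    paramMap (𝟙 X) (r • f) = r • paramMap (𝟙 X) f := by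
  ext1
  ext1
  ext1 V
  change X.obj.map _ ≫ 𝟙 _ = r • (X.obj.map _ ≫ 𝟙 _)
  rw [Category.comp_id, Category.comp_id]
  have h : X.obj.map (DivPow.ihomHom (r • f) (𝟙 V)) =
      r • X.obj.map (DivPow.ihomHom f (𝟙 V)) := by
    rw [DivPow.ihomHom_smul, X.obj.map_smul]
  exact h

/-- The linear map `Hom(X^U, Y) → Hom(X'^{U'}, Y')`, `α ↦ h ∘ α ∘ g^f`, for `f : U ⟶ U'`,
`g : X' ⟶ X` and `h : Y ⟶ Y'`. -/
def homMap {X X' Y Y' : StrictPoly.{w, u} k d} {U U' : DivPow k d} (g : X' ⟶ X) (h : Y ⟶ Y')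
    (f : U ⟶ U') : (param X U ⟶ Y) →ₗ[k] (param X' U' ⟶ Y') :=
  Linear.rightComp k (param X' U') h ∘ₗ Linear.leftComp k Y (paramMap g f)

theorem homMap_apply {X X' Y Y' : StrictPoly.{w, u} k d} {U U' : DivPow k d} (g : X' ⟶ X)
    (h : Y ⟶ Y') (f : U ⟶ U') (α : param X U ⟶ Y) :
    homMap g h f α = (paramMap g f ≫ α) ≫ h := rfl

theorem homMap_id (X Y : StrictPoly.{w, u} k d) (U : DivPow k d) :
    homMap (𝟙 X) (𝟙 Y) (𝟙 U) = LinearMap.id := by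
  ext1 α
  rw [homMap_apply, paramMap_id, Category.id_comp, Category.comp_id, LinearMap.id_apply]

theorem homMap_comp {X X' X'' Y Y' Y'' : StrictPoly.{w, u} k d} {U U' U'' : DivPow k d}
    (g : X' ⟶ X) (g' : X'' ⟶ X') (h : Y ⟶ Y') (h' : Y' ⟶ Y'') (f : U ⟶ U') (f' : U' ⟶ U'') :
    homMap (g' ≫ g) (h ≫ h') (f ≫ f') = homMap g' h' f' ∘ₗ homMap g h f := by
  ext1 α
  rw [LinearMap.comp_apply, homMap_apply, homMap_apply, homMap_apply, paramMap_comp]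
  simp only [Category.assoc]

theorem homMap_comp_id {X X' X'' Y Y' Y'' : StrictPoly.{w, u} k d}
    (g : X' ⟶ X) (g' : X'' ⟶ X') (h : Y ⟶ Y') (h' : Y' ⟶ Y'') (U : DivPow k d) :
    homMap (g' ≫ g) (h ≫ h') (𝟙 U) = homMap g' h' (𝟙 U) ∘ₗ homMap g h (𝟙 U) := by
  rw [← homMap_comp, Category.comp_id]

/-- The internal Hom object: `ℍ(X, Y)(U) = Hom(X^U, Y)`, where `X^U = X(Hom_k(U, -))` and where
`f : U ⟶ U'` acts by precomposition with `X^{U'} ⟶ X^U`. -/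
def internalHomObj (X Y : StrictPoly.{w, u} k d) : StrictPoly.{w, u} k d :=
  ⟨{ obj := fun U => ModuleCat.of k (param X U ⟶ Y)
     map := fun f => ModuleCat.ofHom (homMap (𝟙 X) (𝟙 Y) f)
     map_id := fun U => by
       rw [homMap_id]
       rfl
     map_comp := fun f f' => by
       rw [← ModuleCat.ofHom_comp, ← homMap_comp, Category.comp_id, Category.comp_id] },
   ⟨⟨fun {U U' f f'} => by
      ext1
      ext1 α
      change homMap _ _ _ _ = homMap _ _ _ _ + homMap _ _ _ _
      simp only [homMap_apply, Category.comp_id, paramMap_add, Preadditive.add_comp]⟩,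
    ⟨fun f r => by
      ext1
      ext1 α
      change homMap (𝟙 X) (𝟙 Y) (r • f) α = r • homMap (𝟙 X) (𝟙 Y) f α
      simp only [homMap_apply, Category.comp_id, paramMap_smul, Linear.smul_comp]⟩⟩⟩

/-- The internal Hom as a bifunctor, contravariant in the first variable. -/
def internalHom (k : Type u) [CommRing k] (d : ℕ) :
    (StrictPoly.{w, u} k d)ᵒᵖ × StrictPoly.{w, u} k d ⥤ StrictPoly.{w, u} k d where
  obj P := internalHomObj P.1.unop P.2
  map {P Q} f := ObjectProperty.homMk
    { app := fun U => ModuleCat.ofHom (homMap f.1.unop f.2 (𝟙 U))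
      naturality := fun U U' h => by
        ext1
        change homMap _ _ _ ∘ₗ homMap _ _ _ = homMap _ _ _ ∘ₗ homMap _ _ _
        rw [← homMap_comp, ← homMap_comp]
        simp only [Category.comp_id, Category.id_comp] }
  map_id P := by
    ext1
    ext1
    ext1 U
    exact congrArg ModuleCat.ofHom (homMap_id P.1.unop P.2 U)
  map_comp {P Q R} f g := by
    ext1
    ext1
    ext1 U
    exact congrArg ModuleCat.ofHom (homMap_comp_id f.1.unop g.1.unop f.2 g.2 U)

/-! ### The internal tensor product -/

section Day

open DivPow

/-- The generators of `(X ⊗_int Y)(U)`: the direct sum over all pairs `(V, W)` of the modules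
`Hom(V ⊗ W, U) ⊗ (X(V) ⊗ Y(W))`. -/
abbrev DayGen (X Y : StrictPoly.{w, u} k d) (U : DivPow k d) : Type (max w (u + 1)) :=
  DirectSum (DivPow k d × DivPow k d) fun p =>
    (tens p.1 p.2 ⟶ U) ⊗[k] (X.obj.obj p.1 ⊗[k] Y.obj.obj p.2)

open Classical in
/-- The generator `h ⊗ x ⊗ y` for `h : V ⊗ W ⟶ U`, `x ∈ X(V)` and `y ∈ Y(W)`. -/
def dayGen (X Y : StrictPoly.{w, u} k d) (U V W : DivPow k d) (h : tens V W ⟶ U)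
    (x : X.obj.obj V) (y : Y.obj.obj W) : DayGen X Y U :=
  DirectSum.lof k (DivPow k d × DivPow k d)
    (fun p => (tens p.1 p.2 ⟶ U) ⊗[k] (X.obj.obj p.1 ⊗[k] Y.obj.obj p.2)) (V, W) (h ⊗ₜ (x ⊗ₜ y))

/-- The coend relations `h ∘ (f ⊗ g) ⊗ x ⊗ y = h ⊗ X(f) x ⊗ Y(g) y`. -/
def dayRel (X Y : StrictPoly.{w, u} k d) (U : DivPow k d) : Submodule k (DayGen X Y U) :=
  Submodule.span k {z | ∃ (V V' W W' : DivPow k d) (f : V ⟶ V') (g : W ⟶ W')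
    (h : tens V' W' ⟶ U) (x : X.obj.obj V) (y : Y.obj.obj W),
    z = dayGen X Y U V W (tensHom f g ≫ h) x y -
      dayGen X Y U V' W' h (X.obj.map f x) (Y.obj.map g y)}

/-- The value at `U` of the Day convolution of `X` and `Y`, that is the `k`-linear coend
`∫^{V, W} Hom(V ⊗ W, U) ⊗ X(V) ⊗ Y(W)`. In other words it is the value at `U` of the `k`-linear
colimit of the representable functors `Γ^{d, V ⊗ W} = Hom(V ⊗ W, -)` indexed by the elements of
`X(V)` and of `Y(W)`, that is by the morphisms `Γ^{d, V} ⟶ X` and `Γ^{d, W} ⟶ Y`. -/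
abbrev DayMod (X Y : StrictPoly.{w, u} k d) (U : DivPow k d) : Type (max w (u + 1)) :=
  DayGen X Y U ⧸ dayRel X Y U

/-- The class of `h ⊗ x ⊗ y` in `(X ⊗_int Y)(U)`. -/
def dayMk (X Y : StrictPoly.{w, u} k d) (U V W : DivPow k d) (h : tens V W ⟶ U)
    (x : X.obj.obj V) (y : Y.obj.obj W) : DayMod X Y U :=
  (dayRel X Y U).mkQ (dayGen X Y U V W h x y)

open Classical in
theorem dayMod_ext {X Y : StrictPoly.{w, u} k d} {U : DivPow k d} {M : Type*} [AddCommGroup M]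
    [Module k M] {φ ψ : DayMod X Y U →ₗ[k] M}
    (h : ∀ (V W : DivPow k d) (f : tens V W ⟶ U) (x : X.obj.obj V) (y : Y.obj.obj W),
      φ (dayMk X Y U V W f x y) = ψ (dayMk X Y U V W f x y)) : φ = ψ := by
  apply Submodule.linearMap_qext
  apply DirectSum.linearMap_ext
  rintro ⟨V, W⟩
  apply TensorProduct.ext
  ext1 f
  apply TensorProduct.ext'
  intro x y
  exact h V W f x y

/-- The map on generators induced by `g : X ⟶ X'`, `h : Y ⟶ Y'` and `f : U ⟶ U'`. -/
def dayGenMap {X X' Y Y' : StrictPoly.{w, u} k d} {U U' : DivPow k d} (g : X ⟶ X') (h : Y ⟶ Y')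
    (f : U ⟶ U') : DayGen X Y U →ₗ[k] DayGen X' Y' U' :=
  DirectSum.lmap fun p => TensorProduct.map (Linear.rightComp k (tens p.1 p.2) f)
    (TensorProduct.map (g.hom.app p.1).hom (h.hom.app p.2).hom)

open Classical in
theorem dayGenMap_dayGen {X X' Y Y' : StrictPoly.{w, u} k d} {U U' : DivPow k d} (g : X ⟶ X')
    (h : Y ⟶ Y') (f : U ⟶ U') (V W : DivPow k d) (e : tens V W ⟶ U) (x : X.obj.obj V)
    (y : Y.obj.obj W) : dayGenMap g h f (dayGen X Y U V W e x y) =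
      dayGen X' Y' U' V W (e ≫ f) (g.hom.app V x) (h.hom.app W y) := by
  exact DirectSum.lmap_lof _ _ _

theorem dayRel_le {X X' Y Y' : StrictPoly.{w, u} k d} {U U' : DivPow k d} (g : X ⟶ X') (h : Y ⟶ Y')
    (f : U ⟶ U') : dayRel X Y U ≤ (dayRel X' Y' U').comap (dayGenMap g h f) := by
  refine Submodule.span_le.2 ?_
  rintro _ ⟨V, V', W, W', a, b, e, x, y, rfl⟩
  refine Submodule.subset_span ⟨V, V', W, W', a, b, e ≫ f, g.hom.app V x, h.hom.app W y, ?_⟩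
  rw [map_sub, dayGenMap_dayGen, dayGenMap_dayGen, Category.assoc]
  rw [← NatTrans.naturality_apply, ← NatTrans.naturality_apply]

/-- The map `(X ⊗_int Y)(U) → (X' ⊗_int Y')(U')` induced by `g : X ⟶ X'`, `h : Y ⟶ Y'` and
`f : U ⟶ U'`. -/
def dayMap {X X' Y Y' : StrictPoly.{w, u} k d} {U U' : DivPow k d} (g : X ⟶ X') (h : Y ⟶ Y')
    (f : U ⟶ U') : DayMod X Y U →ₗ[k] DayMod X' Y' U' :=
  Submodule.mapQ _ _ (dayGenMap g h f) (dayRel_le g h f)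

theorem dayMap_dayMk {X X' Y Y' : StrictPoly.{w, u} k d} {U U' : DivPow k d} (g : X ⟶ X')
    (h : Y ⟶ Y') (f : U ⟶ U') (V W : DivPow k d) (e : tens V W ⟶ U) (x : X.obj.obj V)
    (y : Y.obj.obj W) : dayMap g h f (dayMk X Y U V W e x y) =
      dayMk X' Y' U' V W (e ≫ f) (g.hom.app V x) (h.hom.app W y) :=
  congrArg (dayRel X' Y' U').mkQ (dayGenMap_dayGen g h f V W e x y)

theorem dayMap_id (X Y : StrictPoly.{w, u} k d) (U : DivPow k d) :
    dayMap (𝟙 X) (𝟙 Y) (𝟙 U) = LinearMap.id :=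
  dayMod_ext fun V W e x y => by
    rw [dayMap_dayMk, Category.comp_id]
    rfl

theorem dayMap_comp {X X' X'' Y Y' Y'' : StrictPoly.{w, u} k d} {U U' U'' : DivPow k d}
    (g : X ⟶ X') (g' : X' ⟶ X'') (h : Y ⟶ Y') (h' : Y' ⟶ Y'') (f : U ⟶ U') (f' : U' ⟶ U'') :
    dayMap (g ≫ g') (h ≫ h') (f ≫ f') = dayMap g' h' f' ∘ₗ dayMap g h f :=
  dayMod_ext fun V W e x y => by
    rw [LinearMap.comp_apply, dayMap_dayMk, dayMap_dayMk, dayMap_dayMk, Category.assoc]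
    rfl

theorem dayMap_comp_id {X X' X'' Y Y' Y'' : StrictPoly.{w, u} k d}
    (g : X ⟶ X') (g' : X' ⟶ X'') (h : Y ⟶ Y') (h' : Y' ⟶ Y'') (U : DivPow k d) :
    dayMap (g ≫ g') (h ≫ h') (𝟙 U) = dayMap g' h' (𝟙 U) ∘ₗ dayMap g h (𝟙 U) := by
  rw [← dayMap_comp, Category.comp_id]

theorem dayMk_add {X Y : StrictPoly.{w, u} k d} {U V W : DivPow k d} (e e' : tens V W ⟶ U)
    (x : X.obj.obj V) (y : Y.obj.obj W) : dayMk X Y U V W (e + e') x y =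
      dayMk X Y U V W e x y + dayMk X Y U V W e' x y := by
  simp only [dayMk, dayGen, TensorProduct.add_tmul, map_add]

theorem dayMk_smul {X Y : StrictPoly.{w, u} k d} {U V W : DivPow k d} (r : k) (e : tens V W ⟶ U)
    (x : X.obj.obj V) (y : Y.obj.obj W) : dayMk X Y U V W (r • e) x y =
      r • dayMk X Y U V W e x y := by
  simp only [dayMk, dayGen, ← TensorProduct.smul_tmul', map_smul]

/-- The internal tensor product `X ⊗_int Y` (Day convolution) of strict polynomial functors. -/
def internalTensorObj (X Y : StrictPoly.{w, u} k d) : StrictPoly.{w, u} k d :=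
  ⟨{ obj := fun U => ModuleCat.of k (DayMod X Y U)
     map := fun f => ModuleCat.ofHom (dayMap (𝟙 X) (𝟙 Y) f)
     map_id := fun U => by
       rw [dayMap_id]
       rfl
     map_comp := fun f f' => by
       rw [← ModuleCat.ofHom_comp, ← dayMap_comp, Category.comp_id, Category.comp_id] },
   ⟨⟨fun {U U' f f'} => by
      ext1
      change dayMap _ _ _ = dayMap _ _ _ + dayMap _ _ _
      refine dayMod_ext fun V W e x y => ?_
      rw [LinearMap.add_apply, dayMap_dayMk, dayMap_dayMk, dayMap_dayMk, Preadditive.comp_add,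
        dayMk_add]⟩,
    ⟨fun f r => by
      ext1
      change dayMap (𝟙 X) (𝟙 Y) (r • f) = r • dayMap (𝟙 X) (𝟙 Y) f
      refine dayMod_ext fun V W e x y => ?_
      rw [LinearMap.smul_apply, dayMap_dayMk, dayMap_dayMk, Linear.comp_smul, dayMk_smul]⟩⟩⟩

/-- The internal tensor product as a bifunctor. -/
def internalTensor (k : Type u) [CommRing k] (d : ℕ) :
    StrictPoly.{w, u} k d × StrictPoly.{w, u} k d ⥤ StrictPoly.{w, u} k d where
  obj P := internalTensorObj P.1 P.2
  map {P Q} f := ObjectProperty.homMk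
    { app := fun U => ModuleCat.ofHom (dayMap f.1 f.2 (𝟙 U))
      naturality := fun U U' h => by
        ext1
        change dayMap _ _ _ ∘ₗ dayMap _ _ _ = dayMap _ _ _ ∘ₗ dayMap _ _ _
        rw [← dayMap_comp, ← dayMap_comp]
        simp only [Category.comp_id, Category.id_comp] }
  map_id P := by
    ext1
    ext1
    ext1 U
    exact congrArg ModuleCat.ofHom (dayMap_id P.1 P.2 U)
  map_comp {P Q R} f g := by
    ext1
    ext1
    ext1 U
    exact congrArg ModuleCat.ofHom (dayMap_comp_id f.1 g.1 f.2 g.2 U)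

end Day

end StrictPoly

/-! ## The Kronecker tensor product and Hom of representations -/

section Kronecker

variable (k : Type u) [CommRing k] (G : Type) [Group G]

/-- The Kronecker tensor product of representations: `M ⊗_k N` with the diagonal action of `G`. -/
def kron : Rep.{max w (u + 1)} k G × Rep.{max w (u + 1)} k G ⥤ Rep.{max w (u + 1)} k G where
  obj P := Rep.of (P.1.ρ.tprod P.2.ρ)
  map f := Rep.ofHom (f.1.hom.tensor f.2.hom)
  map_id P := by
    ext1
    ext1
    exact TensorProduct.map_id
  map_comp f g := by
    ext1
    ext1
    exact TensorProduct.map_comp _ _ _ _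

/-- The representation `Hom_k(M, N)` with the action `g • φ = g ∘ φ ∘ g⁻¹`. -/
def kronHom : (Rep.{max w (u + 1)} k G)ᵒᵖ × Rep.{max w (u + 1)} k G ⥤
    Rep.{max w (u + 1)} k G where
  obj P := Rep.of (P.1.unop.ρ.linHom P.2.ρ)
  map {P Q} f := Rep.ofHom
    ⟨LinearMap.llcomp k Q.1.unop.V P.2.V Q.2.V f.2.hom.toLinearMap ∘ₗ
        LinearMap.lcomp k P.2.V f.1.unop.hom.toLinearMap, fun g => by
      ext φ x
      have h₁ := Rep.hom_comm_apply f.1.unop g⁻¹ x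
      have h₂ := Rep.hom_comm_apply f.2 g (φ (P.1.unop.ρ g⁻¹ (f.1.unop.hom x)))
      change f.2.hom (P.2.ρ g (φ (P.1.unop.ρ g⁻¹ (f.1.unop.hom x)))) =
        Q.2.ρ g (f.2.hom (φ (f.1.unop.hom (Q.1.unop.ρ g⁻¹ x))))
      rw [h₂, h₁]⟩
  map_id P := by
    ext1
    ext1
    rfl
  map_comp f g := by
    ext1
    ext1
    rfl

end Kronecker

end SPF
end

/-! Let e be the endomorphism of k^d in Γ^d P_k obtained by symmetrizing ⊗_i e_i e_i^*
(`weightIdem`). A morphism k^d ⟶ V that factors through e on the left amounts to a tensor in V^{⊗d},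
so ⊗^d is the direct summand of Hom(k^d, -) cut out by e. By Yoneda, Sch(X) is the image of X(e) in
X(k^d): evaluate at e_1 ⊗ ⋯ ⊗ e_d (`evalBasis`) and return by `ofValue`. The group S_d acts through
permutation of the coordinates of k^d. Dually, for f : V ⟶ k^d the composite f ≫ e amounts to a
tensor in (V*)^{⊗d} (`coords`, `toStd`).

Composites of symmetrizations are computed by the projection formula. The relations e_i^*(e_j) = 0
and e_i e_j = 0 for i ≠ j leave one permutation in each sum (`Gam.map₂_norm_norm`), so d! is never
inverted.

Tensor product: ((V ⊗ W)*)^{⊗d} is (V*)^{⊗d} ⊗ (W*)^{⊗d}, hence a morphism V ⊗ W ⟶ k^d ending in e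
is a sum of pairs V ⟶ k^d, W ⟶ k^d followed by the multiplication of the ring k^d
(`tensHom_toStd_comp_mulStd`). The coend therefore separates, and the co-Yoneda lemma leaves Sch(X)
⊗ Sch(Y).

Internal Hom: pulling back along the diagonal k^d ⟶ End(k^d) turns α : X^{k^d} ⟶ Y into a linear map
Sch(X) → Sch(Y) (`diagValue`). Conversely, let φ be such a map, x ∈ X(Hom(k^d, V)), and let ∑ t_j ⊗
a_j be the canonical element of V^{⊗d} ⊗ (V*)^{⊗d}. Each a_j carries x into Sch(X), and ∑ φ(a_j
x)(t_j) lies in Y(V) (`undiag`). One composite is the identity (`diagValue_undiag`) and the other is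
the action of e (`undiag_diagValue`), which is invisible in Sch(ℍ(X, Y)). -/

noncomputable section

namespace SPF

/-! ### Symmetrization and the projection formula -/

section TensorPowers

variable {k : Type u} [CommRing k] {d : ℕ}
variable {A B C D E F : Type u} [AddCommGroup A] [Module k A] [AddCommGroup B] [Module k B]
  [AddCommGroup C] [Module k C] [AddCommGroup D] [Module k D] [AddCommGroup E] [Module k E]
  [AddCommGroup F] [Module k F]

theorem TPow.hom_ext {f g : TPow k d A →ₗ[k] B}
    (h : ∀ a, f (PiTensorProduct.tprod k a) = g (PiTensorProduct.tprod k a)) : f = g :=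
  PiTensorProduct.ext (MultilinearMap.ext h)

theorem TPow.hom_ext₂ {f g : TPow k d A →ₗ[k] TPow k d B →ₗ[k] C}
    (h : ∀ a b, f (PiTensorProduct.tprod k a) (PiTensorProduct.tprod k b) =
      g (PiTensorProduct.tprod k a) (PiTensorProduct.tprod k b)) : f = g :=
  TPow.hom_ext fun a => TPow.hom_ext fun b => h a b

/-- The norm map `x ↦ ∑ σ, σ x` from the tensor power to the divided power. -/
def TPow.norm (k : Type u) [CommRing k] (d : ℕ) (A : Type u) [AddCommGroup A] [Module k A] :
    TPow k d A →ₗ[k] Gam k d A :=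
  LinearMap.codRestrict _ (permRep k d A).norm fun x σ => (permRep k d A).self_norm_apply σ x

theorem TPow.norm_val (x : TPow k d A) : (TPow.norm k d A x).1 = ∑ σ, permRep k d A σ x := by
  simp [TPow.norm, Representation.norm]

theorem TPow.norm_perm (σ : Equiv.Perm (Fin d)) (x : TPow k d A) :
    TPow.norm k d A (permRep k d A σ x) = TPow.norm k d A x :=
  Subtype.ext ((permRep k d A).norm_self_apply σ x)

/-- The projection formula, on the left. -/
theorem Gam.map₂_norm_left (φ : A →ₗ[k] B →ₗ[k] C) (x : TPow k d A) (y : Gam k d B) :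
    Gam.map₂ φ (TPow.norm k d A x) y = TPow.norm k d C (tmap₂ φ x y.1) := by
  ext1
  rw [Gam.map₂_val, TPow.norm_val, TPow.norm_val, map_sum, LinearMap.sum_apply]
  refine Finset.sum_congr rfl fun σ _ => ?_
  rw [← tmap₂_perm, y.2 σ]

/-- The projection formula, on the right. -/
theorem Gam.map₂_norm_right (φ : A →ₗ[k] B →ₗ[k] C) (x : Gam k d A) (y : TPow k d B) :
    Gam.map₂ φ x (TPow.norm k d B y) = TPow.norm k d C (tmap₂ φ x.1 y) := by
  ext1
  rw [Gam.map₂_val, TPow.norm_val, TPow.norm_val, map_sum]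
  refine Finset.sum_congr rfl fun σ _ => ?_
  rw [← tmap₂_perm, x.2 σ]

theorem tmap₂_tprod_left (φ : A →ₗ[k] B →ₗ[k] C) (a : Fin d → A) (y : TPow k d B) :
    tmap₂ φ (PiTensorProduct.tprod k a) y = PiTensorProduct.map (fun i => φ (a i)) y := by
  induction y using TPow.ind with
  | h b => simp
  | hadd y y' h h' => simp only [map_add, h, h']
  | hsmul r y h => simp only [map_smul, h]

theorem tmap₂_tprod_right (φ : A →ₗ[k] B →ₗ[k] C) (x : TPow k d A) (b : Fin d → B) :
    tmap₂ φ x (PiTensorProduct.tprod k b) = PiTensorProduct.map (fun i => φ.flip (b i)) x := by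
  rw [← tmap₂_flip, tmap₂_tprod_left]

/-- Factorwise bilinear operations commute with families of linear maps. -/
theorem tmap₂_map_map (φ : A →ₗ[k] B →ₗ[k] C) (φ' : D →ₗ[k] E →ₗ[k] F)
    (f : Fin d → A →ₗ[k] D) (g : Fin d → B →ₗ[k] E) (p : Fin d → C →ₗ[k] F)
    (h : ∀ i a b, φ' (f i a) (g i b) = p i (φ a b)) (x : TPow k d A) (y : TPow k d B) :
    tmap₂ φ' (PiTensorProduct.map f x) (PiTensorProduct.map g y) =
      PiTensorProduct.map p (tmap₂ φ x y) := by
  have : (tmap₂ φ').compl₁₂ (PiTensorProduct.map f) (PiTensorProduct.map g) =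
      (tmap₂ φ).compr₂ (PiTensorProduct.map p) := TPow.hom_ext₂ fun a b => by simp [h]
  exact LinearMap.congr_fun (LinearMap.congr_fun this x) y

theorem tmap₂_map_left (φ : A →ₗ[k] B →ₗ[k] C) (φ' : D →ₗ[k] B →ₗ[k] F)
    (f : Fin d → A →ₗ[k] D) (p : Fin d → C →ₗ[k] F)
    (h : ∀ i a b, φ' (f i a) b = p i (φ a b)) (x : TPow k d A) (y : TPow k d B) :
    tmap₂ φ' (PiTensorProduct.map f x) y = PiTensorProduct.map p (tmap₂ φ x y) := by
  simpa using tmap₂_map_map φ φ' f (fun _ => LinearMap.id) p h x y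

theorem tmap₂_map_right (φ : A →ₗ[k] B →ₗ[k] C) (φ' : A →ₗ[k] E →ₗ[k] F)
    (g : Fin d → B →ₗ[k] E) (p : Fin d → C →ₗ[k] F)
    (h : ∀ i a b, φ' a (g i b) = p i (φ a b)) (x : TPow k d A) (y : TPow k d B) :
    tmap₂ φ' x (PiTensorProduct.map g y) = PiTensorProduct.map p (tmap₂ φ x y) := by
  simpa using tmap₂_map_map φ φ' (fun _ => LinearMap.id) g p h x y

theorem TPow.map_map (g : Fin d → B →ₗ[k] C) (f : Fin d → A →ₗ[k] B) (x : TPow k d A) :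
    PiTensorProduct.map g (PiTensorProduct.map f x) =
      PiTensorProduct.map (fun i => g i ∘ₗ f i) x :=
  (LinearMap.congr_fun (PiTensorProduct.map_comp g f) x).symm

theorem TPow.map_perm (f : Fin d → A →ₗ[k] B) (σ : Equiv.Perm (Fin d)) (x : TPow k d A) :
    PiTensorProduct.map f (permRep k d A σ x) =
      permRep k d B σ (PiTensorProduct.map (fun i => f (σ i)) x) := by
  induction x using TPow.ind with
  | h b => simp
  | hadd y y' h h' => simp only [map_add, h, h']
  | hsmul r y h => simp only [map_smul, h]

theorem TPow.norm_map_perm (f : Fin d → A →ₗ[k] B) (σ : Equiv.Perm (Fin d)) (x : TPow k d A) :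
    TPow.norm k d B (PiTensorProduct.map f (permRep k d A σ x)) =
      TPow.norm k d B (PiTensorProduct.map (fun i => f (σ i)) x) := by
  rw [TPow.map_perm, TPow.norm_perm]

theorem exists_symm_ne {σ : Equiv.Perm (Fin d)} (hσ : σ ≠ 1) : ∃ i, σ.symm i ≠ i := by
  by_contra! h
  exact hσ (Equiv.ext fun i => by simpa using (congrArg σ (h i)).symm)

/-- Orthogonal families annihilate all but the trivial permutation in the norm. -/
theorem TPow.map_norm_map (p : Fin d → B →ₗ[k] C) (f : Fin d → A →ₗ[k] B)
    (h : ∀ i j, j ≠ i → ∀ a, p i (f j a) = 0) (x : TPow k d A) :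
    PiTensorProduct.map p (TPow.norm k d B (PiTensorProduct.map f x)).1 =
      PiTensorProduct.map p (PiTensorProduct.map f x) := by
  rw [TPow.norm_val, map_sum, Finset.sum_eq_single 1 _ (by simp)]
  · simp
  · intro σ _ hσ
    -- A nontrivial σ puts a vector from the image of some f j, j ≠ i, into position i, where p i
    -- kills it.
    obtain ⟨i, hi⟩ := exists_symm_ne hσ
    induction x using TPow.ind with
    | h a =>
      rw [PiTensorProduct.map_tprod, permRep_tprod, PiTensorProduct.map_tprod]
      exact MultilinearMap.map_coord_zero _ i (h _ _ hi _)
    | hadd y y' h h' => simp only [map_add, h, h', add_zero]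
    | hsmul r y h => simp only [map_smul, h, smul_zero]

/-- With a pure tensor in the first argument, the maps φ (f i (a i)) form a family orthogonal to g,
so `TPow.map_norm_map` applies. -/
theorem tmap₂_map_norm_map (φ : A →ₗ[k] B →ₗ[k] C) (f : Fin d → D →ₗ[k] A)
    (g : Fin d → E →ₗ[k] B) (h : ∀ i j, j ≠ i → ∀ a b, φ (f i a) (g j b) = 0)
    (x : TPow k d D) (y : TPow k d E) :
    tmap₂ φ (PiTensorProduct.map f x) (TPow.norm k d B (PiTensorProduct.map g y)).1 =
      tmap₂ φ (PiTensorProduct.map f x) (PiTensorProduct.map g y) := by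
  induction x using TPow.ind with
  | h a =>
    rw [PiTensorProduct.map_tprod, tmap₂_tprod_left, tmap₂_tprod_left]
    exact TPow.map_norm_map _ _ (fun i j hij b => h i j hij (a i) b) y
  | hadd y y' h h' => simp only [map_add, LinearMap.add_apply, h, h']
  | hsmul r y h => simp only [map_smul, LinearMap.smul_apply, h]

/-- In general a product of two symmetrizations is a sum of symmetrizations indexed by S_d.
Orthogonality leaves only the term of the identity permutation. -/
theorem Gam.map₂_norm_norm (φ : A →ₗ[k] B →ₗ[k] C) (f : Fin d → D →ₗ[k] A)
    (g : Fin d → E →ₗ[k] B) (h : ∀ i j, j ≠ i → ∀ a b, φ (f i a) (g j b) = 0)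
    (x : TPow k d D) (y : TPow k d E) :
    Gam.map₂ φ (TPow.norm k d A (PiTensorProduct.map f x))
        (TPow.norm k d B (PiTensorProduct.map g y)) =
      TPow.norm k d C (tmap₂ φ (PiTensorProduct.map f x) (PiTensorProduct.map g y)) := by
  rw [Gam.map₂_norm_left, tmap₂_map_norm_map φ f g h]

/-! ### Tensor powers of tensor products -/

theorem listProd_tmul {R S : Type u} [Ring R] [Algebra k R] [Ring S] [Algebra k S]
    {n : ℕ} (a : Fin n → R) (b : Fin n → S) :
    (List.ofFn fun i => a i ⊗ₜ[k] b i).prod = (List.ofFn a).prod ⊗ₜ (List.ofFn b).prod := by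
  induction n with
  | zero => simp [Algebra.TensorProduct.one_def]
  | succ n ih => simp [ih]

/-- The component of degree `d` of the tensor algebra. -/
def tensorAlgebraComponent (k : Type u) [CommRing k] (d : ℕ) (A : Type u) [AddCommGroup A]
    [Module k A] : TensorAlgebra k A →ₗ[k] TPow k d A :=
  DirectSum.component k ℕ (fun n => TPow k n A) d ∘ₗ
    (TensorAlgebra.toDirectSum (R := k) (M := A)).toLinearMap

theorem tensorAlgebraComponent_prod (a : Fin d → A) :
    tensorAlgebraComponent k d A (List.ofFn fun i => TensorAlgebra.ι k (a i)).prod =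
      PiTensorProduct.tprod k a := by
  rw [← TensorAlgebra.tprod_apply]
  simp only [tensorAlgebraComponent, LinearMap.comp_apply, AlgHom.toLinearMap_apply]
  rw [TensorAlgebra.toDirectSum_tensorPower_tprod]
  exact DirectSum.component.lof_self k d _

/-- The linear map `(A ⊗ B)^{⊗ d} → A^{⊗ d} ⊗ B^{⊗ d}` which separates the factors. -/
def TPow.unzip (k : Type u) [CommRing k] (d : ℕ) (A B : Type u) [AddCommGroup A] [Module k A]
    [AddCommGroup B] [Module k B] : TPow k d (A ⊗[k] B) →ₗ[k] TPow k d A ⊗[k] TPow k d B :=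
  TensorProduct.map (tensorAlgebraComponent k d A) (tensorAlgebraComponent k d B) ∘ₗ
    PiTensorProduct.lift
      ((MultilinearMap.mkPiAlgebraFin k d (TensorAlgebra k A ⊗[k] TensorAlgebra k B)).compLinearMap
        fun _ => TensorProduct.map (TensorAlgebra.ι k) (TensorAlgebra.ι k))

/-- In the algebra T(A) ⊗ T(B) the ordered product of the elements a_i ⊗ b_i is (∏ a_i) ⊗ (∏ b_i),
and the degree d part of each ordered product is the pure tensor. -/
theorem TPow.unzip_tprod (a : Fin d → A) (b : Fin d → B) :
    TPow.unzip k d A B (PiTensorProduct.tprod k fun i => a i ⊗ₜ b i) =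
      PiTensorProduct.tprod k a ⊗ₜ PiTensorProduct.tprod k b := by
  simp only [TPow.unzip, LinearMap.comp_apply, PiTensorProduct.lift.tprod,
    MultilinearMap.compLinearMap_apply, TensorProduct.map_tmul, MultilinearMap.mkPiAlgebraFin_apply]
  rw [listProd_tmul, TensorProduct.map_tmul, tensorAlgebraComponent_prod,
    tensorAlgebraComponent_prod]

/-- Pure tensors span A ⊗ B, so it suffices to compare on tensors of elements a_i ⊗ b_i, where the
separation of factors is explicit. -/
theorem tmap₂_unzip (φ : A →ₗ[k] B →ₗ[k] C) (z : TPow k d (A ⊗[k] B)) :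
    TensorProduct.lift (tmap₂ φ) (TPow.unzip k d A B z) =
      PiTensorProduct.map (fun _ => TensorProduct.lift φ) z := by
  refine LinearMap.congr_fun (f := TensorProduct.lift (tmap₂ φ) ∘ₗ TPow.unzip k d A B)
    (PiTensorProduct.ext_of_span_eq_top (g := fun _ (p : A × B) => p.1 ⊗ₜ p.2) (fun _ => ?_)
      fun p => ?_) z
  · refine eq_top_iff.2 ((TensorProduct.span_tmul_eq_top k A B).symm.le.trans
      (Submodule.span_mono ?_))
    rintro _ ⟨a, b, rfl⟩
    exact ⟨(a, b), rfl⟩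
  · simp [TPow.unzip_tprod]

/-- A bilinear map `φ : A × B → C` which exhibits `C` as the tensor product of `A` and `B`
exhibits `C^{⊗ d}` as the tensor product of `A^{⊗ d}` and `B^{⊗ d}`. -/
def TPow.zipEquiv (d : ℕ) (φ : A →ₗ[k] B →ₗ[k] C)
    (hφ : Function.Bijective (TensorProduct.lift φ)) :
    TPow k d A ⊗[k] TPow k d B ≃ₗ[k] TPow k d C :=
  LinearEquiv.ofLinearMap (TensorProduct.lift (tmap₂ φ))
    (TPow.unzip k d A B ∘ₗ
      PiTensorProduct.map fun _ => (LinearEquiv.ofBijective _ hφ).symm.toLinearMap)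
    (TPow.hom_ext fun c => by
      simp only [LinearMap.comp_apply, tmap₂_unzip, PiTensorProduct.map_tprod,
        LinearMap.id_apply]
      congr 1
      ext i
      exact (LinearEquiv.ofBijective _ hφ).apply_symm_apply (c i))
    (TensorProduct.ext (TPow.hom_ext₂ fun a b => by
      have h (i : Fin d) : (LinearEquiv.ofBijective _ hφ).symm (φ (a i) (b i)) = a i ⊗ₜ b i :=
        (LinearEquiv.symm_apply_eq _).2 (by simp)
      simp [TPow.unzip_tprod, h]))

/-- By currying, (V ⊗ W)* is Hom(V, W*), and V* ⊗ W* → Hom(V, W*) is bijective since V is finitely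
generated projective. -/
theorem dualDistrib_bijective (V W : Type u) [AddCommGroup V] [Module k V] [AddCommGroup W]
    [Module k W] [Module.Finite k V] [Module.Projective k V] :
    Function.Bijective (TensorProduct.dualDistrib k V W) := by
  have h : TensorProduct.dualDistrib k V W =
      (TensorProduct.lift.equiv (RingHom.id k) V W k).toLinearMap ∘ₗ
        dualTensorHom k V (Module.Dual k W) := by
    ext f g v w
    simp
  rw [h]
  exact (TensorProduct.lift.equiv (RingHom.id k) V W k).bijective.comp dualTensorHom_bijective

/-- The bilinear map `V* × W* → (V ⊗ W)*`. -/
def dualPair (V W : Type u) [AddCommGroup V] [Module k V] [AddCommGroup W] [Module k W] :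
    Module.Dual k V →ₗ[k] Module.Dual k W →ₗ[k] Module.Dual k (V ⊗[k] W) :=
  TensorProduct.curry (TensorProduct.dualDistrib k V W)

@[simp]
theorem dualPair_apply {V W : Type u} [AddCommGroup V] [Module k V] [AddCommGroup W] [Module k W]
    (f : Module.Dual k V) (g : Module.Dual k W) (v : V) (w : W) :
    dualPair V W f g (v ⊗ₜ w) = f v * g w := rfl

theorem dualPair_bijective (V W : Type u) [AddCommGroup V] [Module k V] [AddCommGroup W]
    [Module k W] [Module.Finite k V] [Module.Projective k V] :
    Function.Bijective (TensorProduct.lift (dualPair (k := k) V W)) := by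
  have h : TensorProduct.lift (dualPair (k := k) V W) = TensorProduct.dualDistrib k V W :=
    TensorProduct.ext' fun _ _ => rfl
  rw [h]
  exact dualDistrib_bijective V W

/-- The bilinear map `W × V* → Hom(V, W)`. -/
def rankOne (V W : Type u) [AddCommGroup V] [Module k V] [AddCommGroup W] [Module k W] :
    W →ₗ[k] Module.Dual k V →ₗ[k] (V →ₗ[k] W) :=
  (LinearMap.smulRightₗ (R := k) (M := W) (M₂ := V)).flip

@[simp]
theorem rankOne_apply {V W : Type u} [AddCommGroup V] [Module k V] [AddCommGroup W] [Module k W]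
    (w : W) (f : Module.Dual k V) (v : V) : rankOne V W w f v = f v • w := rfl

theorem rankOne_bijective (V W : Type u) [AddCommGroup V] [Module k V] [AddCommGroup W]
    [Module k W] [Module.Finite k V] [Module.Projective k V] :
    Function.Bijective (TensorProduct.lift (rankOne (k := k) V W)) := by
  have h : TensorProduct.lift (rankOne (k := k) V W) =
      dualTensorHom k V W ∘ₗ (TensorProduct.comm k W (Module.Dual k V)).toLinearMap := by
    ext f g v
    simp
  rw [h]
  exact dualTensorHom_bijective.comp (LinearEquiv.bijective _)

end TensorPowers

/-! ### The object k^d and its weight idempotent -/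

namespace DivPow

variable {k : Type u} [CommRing k] {d : ℕ}

/-- The free module `k^d` as an object of `Γ^d P_k`. -/
abbrev std (k : Type u) [CommRing k] (d : ℕ) : DivPow k d := ⟨Fin d → k⟩

/-- The tensor `e_1 ⊗ ⋯ ⊗ e_d` of the standard basis vectors. -/
def basisTensor (k : Type u) [CommRing k] (d : ℕ) : TPow k d (std k d).carrier :=
  PiTensorProduct.tprod k fun i => (Pi.single i 1 : Fin d → k)

/-- The tensor `e_1^* ⊗ ⋯ ⊗ e_d^*` of the coordinate functions. -/
def coordTensor (k : Type u) [CommRing k] (d : ℕ) : TPow k d (Module.Dual k (std k d).carrier) :=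
  PiTensorProduct.tprod k fun i => (LinearMap.proj i : (Fin d → k) →ₗ[k] k)

/-- The morphism `k^d ⟶ V` with `e_1 ⊗ ⋯ ⊗ e_d ↦ t`, the symmetrization of
`⊗_i v_i e_i^*` for `t = ⊗_i v_i`. -/
def ofStd (V : DivPow k d) : TPow k d V.carrier →ₗ[k] (std k d ⟶ V) :=
  TPow.norm k d ((Fin d → k) →ₗ[k] V.carrier) ∘ₗ
    PiTensorProduct.map fun i => (rankOne (Fin d → k) V.carrier).flip (LinearMap.proj i)

/-- The morphism `V ⟶ k^d` with coordinates the tensor `a` of linear forms, the symmetrization of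
`⊗_i e_i ψ_i` for `a = ⊗_i ψ_i`. -/
def toStd (V : DivPow k d) : TPow k d (Module.Dual k V.carrier) →ₗ[k] (V ⟶ std k d) :=
  TPow.norm k d (V.carrier →ₗ[k] (Fin d → k)) ∘ₗ
    PiTensorProduct.map fun i => rankOne V.carrier (Fin d → k) (Pi.single i 1)

/-- The contravariant action of a morphism `V ⟶ W` on tensor powers of dual modules. -/
def dualEval {V W : DivPow k d} (f : V ⟶ W) :
    TPow k d (Module.Dual k W.carrier) →ₗ[k] TPow k d (Module.Dual k V.carrier) :=
  tmap₂ (compL V.carrier W.carrier k) f.1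

/-- The coordinates of a morphism to `k^d`. -/
def coords {V : DivPow k d} : (V ⟶ std k d) →ₗ[k] TPow k d (Module.Dual k V.carrier) :=
  (tmap₂ (compL V.carrier (std k d).carrier k)).flip (coordTensor k d) ∘ₗ
    (Gam k d (V.carrier →ₗ[k] (std k d).carrier)).subtype

theorem coords_eq_dualEval {V : DivPow k d} (f : V ⟶ std k d) :
    coords f = dualEval f (coordTensor k d) := rfl

/-- The idempotent endomorphism of `k^d` which projects onto the weight space `(1, …, 1)`. -/
def weightIdem (k : Type u) [CommRing k] (d : ℕ) : std k d ⟶ std k d :=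
  ofStd (std k d) (basisTensor k d)

/-- The tensor ⊗_i e_i e_i^* is symmetric in vectors and forms, so the idempotent can be used both
as a morphism out of k^d and as one into k^d. -/
theorem weightIdem_eq : weightIdem k d = toStd (std k d) (coordTensor k d) := by
  simp only [weightIdem, ofStd, toStd, LinearMap.comp_apply, basisTensor, coordTensor]
  rw [PiTensorProduct.map_tprod, PiTensorProduct.map_tprod]
  rfl

/-- Since e_j^*(e_i) = 0 for j ≠ i, only the identity permutation contributes. This splits ⊗^d off
Hom(k^d, -). -/
theorem evalL_ofStd {V : DivPow k d} (t : TPow k d V.carrier) :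
    evalL (std k d) V (ofStd V t) (basisTensor k d) = t := by
  rw [evalL_apply, basisTensor]
  refine (tmap₂_tprod_right _ _ _).trans ?_
  refine (TPow.map_norm_map _ _ (fun i j hij a => ?_) t).trans ?_
  · simp [hij]
  · rw [TPow.map_map]
    refine (congrArg (fun g => PiTensorProduct.map g t) (funext fun i => ?_)).trans
      (LinearMap.congr_fun PiTensorProduct.map_id t)
    ext v
    simp

/-- The element f is symmetric, so it moves inside the symmetrization by the projection formula.
Thus `ofStd` is natural in V. -/
theorem ofStd_comp {V W : DivPow k d} (t : TPow k d V.carrier) (f : V ⟶ W) :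
    ofStd V t ≫ f = ofStd W (evalL V W f t) := by
  refine (Gam.map₂_norm_left _ _ _).trans (congrArg _ ?_)
  rw [evalL_apply, ← tmap₂_flip LinearMap.id]
  exact tmap₂_map_left _ _ _ _ (fun i v g => by ext; simp) _ _

theorem comp_toStd {V W : DivPow k d} (f : V ⟶ W) (a : TPow k d (Module.Dual k W.carrier)) :
    f ≫ toStd W a = toStd V (dualEval f a) := by
  refine (Gam.map₂_norm_right _ _ _).trans (congrArg _ ?_)
  exact tmap₂_map_right _ _ _ _ (fun i v g => by ext; simp) _ _

/-- Together with `coords_toStd`, this identifies the morphisms into k^d fixed by the idempotent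
with (V*)^{⊗d}. -/
theorem comp_weightIdem {V : DivPow k d} (f : V ⟶ std k d) :
    f ≫ weightIdem k d = toStd V (coords f) := by
  rw [weightIdem_eq, comp_toStd, coords_eq_dualEval]

theorem dualEval_comp {U V W : DivPow k d} (f : U ⟶ V) (g : V ⟶ W)
    (a : TPow k d (Module.Dual k W.carrier)) : dualEval (f ≫ g) a = dualEval f (dualEval g a) :=
  tmap₂_assoc _ _ _ _ (fun _ _ _ => rfl) _ _ _

theorem coords_comp {V W : DivPow k d} (f : V ⟶ W) (g : W ⟶ std k d) :
    coords (f ≫ g) = dualEval f (coords g) := dualEval_comp _ _ _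

theorem coords_toStd {V : DivPow k d} (a : TPow k d (Module.Dual k V.carrier)) :
    coords (toStd V a) = a := by
  refine (tmap₂_tprod_right _ _ _).trans ?_
  refine (TPow.map_norm_map _ _ (fun i j hij a => ?_) a).trans ?_
  · ext
    simp [hij.symm]
  · rw [TPow.map_map]
    refine (congrArg (fun g => PiTensorProduct.map g a) (funext fun i => ?_)).trans
      (LinearMap.congr_fun PiTensorProduct.map_id a)
    ext v
    simp

theorem toStd_comp_weightIdem {V : DivPow k d} (a : TPow k d (Module.Dual k V.carrier)) :
    toStd V a ≫ weightIdem k d = toStd V a := by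
  rw [comp_weightIdem, coords_toStd]

/-- The endomorphism `e_i ↦ e_{σ i}` of `k^d`. -/
def permStd (k : Type u) [CommRing k] {d : ℕ} (σ : Equiv.Perm (Fin d)) : std k d ⟶ std k d :=
  Gam.pure k d (LinearMap.funLeft k k σ.symm)

/-- Relabelling the basis by σ puts e_{σ i} in position i, which is the place permutation by σ⁻¹.
This matches the inverse in `schRep`. -/
theorem evalL_permStd (σ : Equiv.Perm (Fin d)) :
    evalL _ _ (permStd k σ) (basisTensor k d) = permRep k d _ σ⁻¹ (basisTensor k d) := by
  rw [evalL_apply]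
  refine (tmap₂_tprod _ _ _).trans ((congrArg _ (funext fun i => ?_)).trans
    (permRep_tprod _ _).symm)
  ext j
  simp [LinearMap.funLeft, Pi.single_apply, Equiv.symm_apply_eq]
  rfl

/-- Composition with `permStd k σ` replaces e_i^* by e_{σ⁻¹ i}^*; the symmetrization absorbs this
reindexing into a place permutation of t. -/
theorem permStd_comp_ofStd {V : DivPow k d} (σ : Equiv.Perm (Fin d)) (t : TPow k d V.carrier) :
    permStd k σ ≫ ofStd V t = ofStd V (permRep k d _ σ⁻¹ t) := by
  refine (Gam.map₂_norm_right _ _ _).trans ?_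
  refine Eq.trans ?_ (TPow.norm_map_perm _ _ _).symm
  refine congrArg _ ((tmap₂_tprod_left _ _ _).trans ((TPow.map_map _ _ _).trans ?_))
  refine congrArg (fun g => PiTensorProduct.map g t) (funext fun i => ?_)
  ext v j
  simp [LinearMap.funLeft]

/-! ### The diagonal of `k^d` and tensor products -/

/-- The multiplication `k^d ⊗ k^d ⟶ k^d`. -/
def mulStd (k : Type u) [CommRing k] (d : ℕ) : tens (std k d) (std k d) ⟶ std k d :=
  Gam.pure k d (LinearMap.mul' k (Fin d → k))

/-- Permutations of coordinates are ring automorphisms of k^d. -/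
theorem tensHom_permStd_comp_mulStd (σ : Equiv.Perm (Fin d)) :
    tensHom (permStd k σ) (permStd k σ) ≫ mulStd k d = mulStd k d ≫ permStd k σ := by
  refine (congrArg (· ≫ mulStd k d) (Gam.map₂_pure _ _ _)).trans
    ((Gam.map₂_pure _ _ _).trans (Eq.trans (congrArg _ ?_) (Gam.map₂_pure _ _ _).symm))
  apply TensorProduct.ext'
  intro x y
  rfl

theorem tmap₂_compr₂ {A B C D : Type u} [AddCommGroup A] [Module k A] [AddCommGroup B] [Module k B]
    [AddCommGroup C] [Module k C] [AddCommGroup D] [Module k D] (φ : A →ₗ[k] B →ₗ[k] C)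
    (p : C →ₗ[k] D) (x : TPow k d A) (y : TPow k d B) :
    tmap₂ (φ.compr₂ p) x y = PiTensorProduct.map (fun _ => p) (tmap₂ φ x y) := by
  simpa using tmap₂_map_map φ (φ.compr₂ p) (fun _ => LinearMap.id) (fun _ => LinearMap.id)
    (fun _ => p) (fun _ _ _ => rfl) x y

/-- The relations e_i e_j = 0 for i ≠ j and e_i e_i = e_i collapse the double symmetrization to a
single one, in which the i-th forms of a and b are paired. -/
theorem tensHom_toStd_comp_mulStd {V W : DivPow k d} (a : TPow k d (Module.Dual k V.carrier))
    (b : TPow k d (Module.Dual k W.carrier)) :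
    tensHom (toStd V a) (toStd W b) ≫ mulStd k d =
      toStd (tens V W) (tmap₂ (dualPair V.carrier W.carrier) a b) := by
  -- The multiplication is absorbed into the bilinear map, so that the product of two norms becomes
  -- visible.
  have h : tensHom (toStd V a) (toStd W b) ≫ mulStd k d = Gam.map₂
      ((tensL V.carrier (Fin d → k) W.carrier (Fin d → k)).compr₂
        ((compL _ _ (Fin d → k)).flip (LinearMap.mul' k (Fin d → k)))) (toStd V a) (toStd W b) :=
    Subtype.ext ((tmap₂_tprod_right _ _ _).trans (tmap₂_compr₂ _ _ _ _).symm)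
  rw [h]
  refine (Gam.map₂_norm_norm _ _ _ (fun i j hij f g => ?_) a b).trans (congrArg _ ?_)
  · apply TensorProduct.ext'
    intro v w
    simp [← Pi.single_mul_left, hij]
  · refine tmap₂_map_map _ _ _ _ _ (fun i f g => ?_) a b
    apply TensorProduct.ext'
    intro v w
    change (f v • Pi.single i 1) * (g w • Pi.single i 1) = (f v * g w) • (Pi.single i 1 : Fin d → k)
    rw [smul_mul_smul_comm, ← Pi.single_mul, mul_one]

theorem coords_mulStd : coords (mulStd k d) =
    tmap₂ (dualPair (std k d).carrier (std k d).carrier) (coordTensor k d) (coordTensor k d) := by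
  refine (tmap₂_tprod _ _ _).trans (Eq.trans (congrArg _ (funext fun i => ?_))
    (tmap₂_tprod _ _ _).symm)
  apply TensorProduct.ext'
  intro v w
  rfl

/-! ### The canonical element of `V ⊗ V*` -/

/-- The isomorphism `V^{⊗ d} ⊗ (V*)^{⊗ d} ≃ End(V)^{⊗ d}`. -/
def endEquiv (V : DivPow k d) :
    TPow k d V.carrier ⊗[k] TPow k d (Module.Dual k V.carrier) ≃ₗ[k]
      TPow k d (V.carrier →ₗ[k] V.carrier) :=
  TPow.zipEquiv d (rankOne V.carrier V.carrier) (rankOne_bijective _ _)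

/-- The canonical element of `V^{⊗ d} ⊗ (V*)^{⊗ d}`. -/
def coev (V : DivPow k d) : TPow k d V.carrier ⊗[k] TPow k d (Module.Dual k V.carrier) :=
  (endEquiv V).symm (Gam.pure k d LinearMap.id).1

theorem endEquiv_coev (V : DivPow k d) :
    endEquiv V (coev V) = PiTensorProduct.tprod k fun _ => LinearMap.id :=
  (endEquiv V).apply_symm_apply _

theorem lift_rankOne_coev (V : DivPow k d) :
    TensorProduct.lift (tmap₂ (rankOne V.carrier V.carrier)) (coev V) =
      PiTensorProduct.tprod k fun _ => LinearMap.id := endEquiv_coev V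

/-- The pairing of `(V*)^{⊗ d}` with `V^{⊗ d}`. -/
def pairing (V : DivPow k d) :
    TPow k d (Module.Dual k V.carrier) →ₗ[k] TPow k d V.carrier →ₗ[k] k :=
  (tmap₂ (LinearMap.id : Module.Dual k V.carrier →ₗ[k] V.carrier →ₗ[k] k)).compr₂
    (PiTensorProduct.lift (MultilinearMap.mkPiAlgebra k (Fin d) k))

theorem pairing_tprod (V : DivPow k d) (a : Fin d → Module.Dual k V.carrier)
    (v : Fin d → V.carrier) :
    pairing V (PiTensorProduct.tprod k a) (PiTensorProduct.tprod k v) = ∏ i, a i (v i) := by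
  simp [pairing]

/-- The linear map `t ⊗ a ↦ ⟨a, u⟩ t` sends the canonical element to `u`. -/
theorem pairing_coev (V : DivPow k d) (u : TPow k d V.carrier) :
    TensorProduct.rid k _ (((pairing V).flip u).lTensor _ (coev V)) = u := by
  -- For every z, contraction with u is evaluation at u of the tensor of endomorphisms attached to
  -- z; for the canonical element that tensor is the identity.
  have h (z : TPow k d V.carrier ⊗[k] TPow k d (Module.Dual k V.carrier)) :
      TensorProduct.rid k _ (((pairing V).flip u).lTensor _ z) =
        tmap₂ LinearMap.id (TensorProduct.lift (tmap₂ (rankOne V.carrier V.carrier)) z) u := by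
    induction z with
    | zero => simp
    | add x y hx hy => simp only [map_add, LinearMap.add_apply, hx, hy]
    | tmul t a =>
      simp only [LinearMap.lTensor_tmul, TensorProduct.rid_tmul, TensorProduct.lift.tmul,
        LinearMap.flip_apply]
      induction t using TPow.ind with
      | hadd x y hx hy => simp only [map_add, LinearMap.add_apply, smul_add, hx, hy]
      | hsmul r x hx => simp only [map_smul, LinearMap.smul_apply, ← hx, smul_comm r]
      | h v =>
        induction a using TPow.ind with
        | hadd x y hx hy => simp only [map_add, LinearMap.add_apply, add_smul, hx, hy]
        | hsmul r x hx => simp only [map_smul, LinearMap.smul_apply, ← hx, smul_assoc]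
        | h a =>
          induction u using TPow.ind with
          | hadd x y hx hy => simp only [map_add, add_smul, hx, hy]
          | hsmul r x hx => simp only [map_smul, ← hx, smul_assoc]
          | h u =>
            rw [pairing_tprod, tmap₂_tprod, tmap₂_tprod, ← MultilinearMap.map_smul_univ]
            rfl
  rw [h, lift_rankOne_coev]
  exact tmap₂_pure_left _ _ (fun _ => rfl) u

/-! ### The diagonal of `k^d` and internal Hom objects -/

/-- The morphism `k^d ⟶ End(k^d)` with `e_i ↦ e_i e_i^*`. -/
def diagStd (k : Type u) [CommRing k] (d : ℕ) : std k d ⟶ ihom (std k d) (std k d) :=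
  Gam.pure k d (LinearMap.mul k (Fin d → k))

/-- The map `(V*)^{⊗ d} → (Hom(k^d, V)*)^{⊗ d}` with `⊗_i ψ_i ↦ ⊗_i (h ↦ ψ_i (h e_i))`. -/
def evalBasisDual (V : DivPow k d) : TPow k d (Module.Dual k V.carrier) →ₗ[k]
    TPow k d (Module.Dual k (ihom (std k d) V).carrier) :=
  PiTensorProduct.map fun i => compL ((Fin d → k) →ₗ[k] V.carrier) V.carrier k
    (LinearMap.applyₗ (Pi.single i 1))

theorem ihomHom_comp_evalBasisDual {V W : DivPow k d} (f : V ⟶ W)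
    (a : TPow k d (Module.Dual k W.carrier)) :
    ihomHom (𝟙 (std k d)) f ≫ toStd _ (evalBasisDual W a) =
      toStd _ (evalBasisDual V (dualEval f a)) := by
  rw [comp_toStd]
  refine congrArg _ ((congrArg (fun z => tmap₂ (compL _ _ _) z (evalBasisDual W a))
    (tmap₂_tprod_left _ _ _)).trans (tmap₂_map_map _ _ _ _ _ (fun i f a => ?_) _ _))
  rfl

section RankOne

variable {V W : Type u} [AddCommGroup V] [Module k V] [AddCommGroup W] [Module k W]

theorem tmap₂_rankOne_comp_left (f : TPow k d (V →ₗ[k] W)) (t : TPow k d V)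
    (a : TPow k d (Module.Dual k V)) :
    tmap₂ (rankOne V W) (tmap₂ (LinearMap.id : (V →ₗ[k] W) →ₗ[k] V →ₗ[k] W) f t) a =
      tmap₂ (LinearMap.llcomp k V V W) f (tmap₂ (rankOne V V) t a) :=
  tmap₂_assoc _ _ _ _ (fun f v a => LinearMap.ext fun x => (map_smul f (a x) v).symm) f t a

theorem tmap₂_rankOne_comp_right (f : TPow k d (V →ₗ[k] W)) (t : TPow k d W)
    (a : TPow k d (Module.Dual k W)) :
    tmap₂ (rankOne V W) t (tmap₂ (compL V W k) f a) =
      tmap₂ (LinearMap.llcomp k V W W) (tmap₂ (rankOne W W) t a) f := by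
  rw [← tmap₂_flip (compL V W k)]
  symm
  apply tmap₂_assoc
  intro w a f
  rfl

end RankOne

/-- Under W^{⊗d} ⊗ (V*)^{⊗d} ≃ Hom(V, W)^{⊗d} both sides become f itself. This dinaturality makes
`undiag` natural. -/
theorem map_coev {V W : DivPow k d} (f : V ⟶ W) :
    (evalL V W f).rTensor _ (coev V) = (dualEval f).lTensor _ (coev W) := by
  let e := TPow.zipEquiv d (rankOne (k := k) V.carrier W.carrier)
    (rankOne_bijective V.carrier W.carrier)
  have h₁ (z : TPow k d V.carrier ⊗[k] TPow k d (Module.Dual k V.carrier)) :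
      e ((evalL V W f).rTensor _ z) = tmap₂ (LinearMap.llcomp k V.carrier V.carrier W.carrier) f.1
        (TensorProduct.lift (tmap₂ (rankOne V.carrier V.carrier)) z) := by
    induction z with
    | zero => simp
    | add x y hx hy => simp only [map_add, hx, hy]
    | tmul t a => exact tmap₂_rankOne_comp_left f.1 t a
  have h₂ (z : TPow k d W.carrier ⊗[k] TPow k d (Module.Dual k W.carrier)) :
      e ((dualEval f).lTensor _ z) = tmap₂ (LinearMap.llcomp k V.carrier W.carrier W.carrier)
        (TensorProduct.lift (tmap₂ (rankOne W.carrier W.carrier)) z) f.1 := by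
    induction z with
    | zero => simp
    | add x y hx hy => simp only [map_add, LinearMap.add_apply, hx, hy]
    | tmul t a => exact tmap₂_rankOne_comp_right f.1 t a
  refine e.injective ?_
  rw [h₁, h₂, lift_rankOne_coev, lift_rankOne_coev]
  exact (tmap₂_pure_right _ _ (fun _ => rfl) _).trans (tmap₂_pure_left _ _ (fun _ => rfl) _).symm

theorem mul_single_one (x : Fin d → k) (i : Fin d) :
    x * Pi.single i 1 = x i • (Pi.single i 1 : Fin d → k) := by
  ext j
  by_cases h : j = i
  · subst h
    simp
  · simp [h]

theorem weightIdem_eq_norm : weightIdem k d = TPow.norm k d ((Fin d → k) →ₗ[k] (Fin d → k))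
    (PiTensorProduct.tprod k fun i => rankOne _ _ (Pi.single i 1) (LinearMap.proj i)) := by
  simp only [weightIdem, ofStd, LinearMap.comp_apply, basisTensor, PiTensorProduct.map_tprod]
  rfl

/-- Multiplication by x sends e_i to x_i e_i, so ψ_i(x e_i) = ψ_i(e_i) x_i. The scalars ψ_i(e_i)
multiply to the pairing and the coordinate forms x_i remain. -/
theorem diagStd_comp_evalBasisDual (a : TPow k d (Module.Dual k (std k d).carrier)) :
    diagStd k d ≫ toStd _ (evalBasisDual _ a) = pairing _ a (basisTensor k d) • weightIdem k d := by
  rw [comp_toStd, weightIdem_eq, ← map_smul]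
  refine congrArg _ ((tmap₂_tprod_left _ _ _).trans ((TPow.map_map _ _ _).trans ?_))
  induction a using TPow.ind with
  | hadd x y hx hy => simp only [map_add, LinearMap.add_apply, add_smul, hx, hy]
  | hsmul r x hx => simp only [map_smul, LinearMap.smul_apply, hx, smul_assoc]
  | h a =>
    rw [basisTensor, pairing_tprod, coordTensor, ← MultilinearMap.map_smul_univ,
      PiTensorProduct.map_tprod]
    congr 1
    funext i
    refine LinearMap.ext fun x => ?_
    change a i (x * Pi.single i 1) = a i (Pi.single i 1) * x i
    rw [mul_single_one, map_smul, smul_eq_mul, mul_comm]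


/-- Factorwise, x · (y_i e_i) = x_i y_i e_i = (x_i e_i) · y, so the idempotent passes from the
parameter of Hom(k^d, -) to the source of the diagonal. -/
theorem diagStd_comp_ihomHom_weightIdem :
    diagStd k d ≫ ihomHom (weightIdem k d) (𝟙 (std k d)) = weightIdem k d ≫ diagStd k d := by
  rw [weightIdem_eq_norm]
  refine (congrArg (diagStd k d ≫ ·) (Gam.map₂_norm_left _ _ _)).trans
    ((Gam.map₂_norm_right _ _ _).trans (Eq.trans (congrArg _ ?_) (Gam.map₂_norm_left _ _ _).symm))
  refine (congrArg (tmap₂ _ _) (tmap₂_tprod _ _ _)).trans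
    ((tmap₂_tprod _ _ _).trans (Eq.trans (congrArg _ (funext fun i => ?_))
      (tmap₂_tprod _ _ _).symm))
  refine LinearMap.ext fun x => LinearMap.ext fun y => ?_
  change x * (y i • Pi.single i 1) = (x i • Pi.single i 1) * y
  rw [mul_smul_comm, mul_single_one, smul_mul_assoc, mul_comm _ y, mul_single_one, smul_comm]

/-- This is x · σ(y) = σ(σ⁻¹(x) · y), the origin of the conjugation action on Hom(Sch(X), Sch(Y)).
-/
theorem diagStd_comp_ihomHom_permStd (σ : Equiv.Perm (Fin d)) :
    diagStd k d ≫ ihomHom (permStd k σ) (𝟙 (std k d)) =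
      permStd k σ⁻¹ ≫ diagStd k d ≫ ihomHom (𝟙 (std k d)) (permStd k σ) := by
  refine (congrArg (diagStd k d ≫ ·) (Gam.map₂_pure _ _ _)).trans
    ((Gam.map₂_pure _ _ _).trans (Eq.trans (congrArg _ ?_) ((congrArg (permStd k σ⁻¹ ≫ ·)
      ((congrArg (diagStd k d ≫ ·) (Gam.map₂_pure _ _ _)).trans (Gam.map₂_pure _ _ _))).trans
        (Gam.map₂_pure _ _ _)).symm))
  refine LinearMap.ext fun x => LinearMap.ext fun y => funext fun i => ?_
  change x i * y (σ.symm i) = x (σ (σ.symm i)) * y (σ.symm i)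
  rw [Equiv.apply_symm_apply]

section RestrictBasis

variable (V : Type u) [AddCommGroup V] [Module k V]

/-- The linear map `(h ↦ ψ (h e_i)) ⊗ e_i` attached to a linear form `ψ`. -/
def evalRankOne (i : Fin d) :
    Module.Dual k V →ₗ[k] (((Fin d → k) →ₗ[k] V) →ₗ[k] (Fin d → k)) :=
  rankOne ((Fin d → k) →ₗ[k] V) (Fin d → k) (Pi.single i 1) ∘ₗ
    compL ((Fin d → k) →ₗ[k] V) V k (LinearMap.applyₗ (Pi.single i 1))

@[simp]
theorem evalRankOne_apply (i : Fin d) (ψ : Module.Dual k V) (h : (Fin d → k) →ₗ[k] V) :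
    evalRankOne V i ψ h = ψ (h (Pi.single i 1)) • (Pi.single i 1 : Fin d → k) := rfl

/-- The linear map `x ↦ (y ↦ x_i y_i v)` attached to a vector `v`. -/
def diagRankOne (i : Fin d) :
    V →ₗ[k] ((Fin d → k) →ₗ[k] (Fin d → k) →ₗ[k] V) :=
  compL (Fin d → k) ((Fin d → k) →ₗ[k] (Fin d → k)) ((Fin d → k) →ₗ[k] V)
      (LinearMap.mul k (Fin d → k)) ∘ₗ
    ihomL (Fin d → k) (Fin d → k) (Fin d → k) V LinearMap.id ∘ₗ
      (rankOne (Fin d → k) V).flip (LinearMap.proj i)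

@[simp]
theorem diagRankOne_apply (i : Fin d) (v : V) (x y : Fin d → k) :
    diagRankOne V i v x y = (x i * y i) • v := rfl

/-- The map sending `⊗_i g_i` to the symmetrization of `⊗_i (h ↦ g_i ∘ h ∘ e_i e_i^*)`. -/
def restrictBasis : TPow k d (V →ₗ[k] V) →ₗ[k]
    Gam k d (((Fin d → k) →ₗ[k] V) →ₗ[k] ((Fin d → k) →ₗ[k] V)) :=
  TPow.norm k d (((Fin d → k) →ₗ[k] V) →ₗ[k] ((Fin d → k) →ₗ[k] V)) ∘ₗ
    PiTensorProduct.map fun i => ihomL (Fin d → k) (Fin d → k) V V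
      (rankOne (Fin d → k) (Fin d → k) (Pi.single i 1) (LinearMap.proj i))

theorem restrictBasis_pure (g : V →ₗ[k] V) :
    restrictBasis V (PiTensorProduct.tprod k fun _ => g) =
      Gam.map₂ (ihomL (Fin d → k) (Fin d → k) V V) (TPow.norm k d ((Fin d → k) →ₗ[k] (Fin d → k))
        (PiTensorProduct.tprod k fun i => rankOne _ _ (Pi.single i 1) (LinearMap.proj i)))
        (Gam.pure k d g) := by
  rw [Gam.map₂_norm_left, restrictBasis, LinearMap.comp_apply, PiTensorProduct.map_tprod]
  exact congrArg _ (tmap₂_tprod _ _ _).symm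

/-- The composite of h ↦ ψ(h e_i) e_i with x ↦ (y ↦ x_j y_j v) vanishes for i ≠ j, and for i = j it
is h ↦ (v ψ) ∘ h ∘ e_i e_i^*. -/
theorem map₂_evalRankOne_diagRankOne (t : TPow k d V) (a : TPow k d (Module.Dual k V)) :
    Gam.map₂ (compL ((Fin d → k) →ₗ[k] V) (Fin d → k) ((Fin d → k) →ₗ[k] V))
        (TPow.norm k d _ (PiTensorProduct.map (evalRankOne V) a))
        (TPow.norm k d _ (PiTensorProduct.map (diagRankOne V) t)) =
      restrictBasis V (tmap₂ (rankOne V V) t a) := by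
  rw [Gam.map₂_norm_norm, restrictBasis, LinearMap.comp_apply, ← tmap₂_flip (rankOne V V) t a]
  · refine congrArg _ (tmap₂_map_map _ _ _ _ _ (fun i f g => ?_) a t)
    refine LinearMap.ext fun h => LinearMap.ext fun x => ?_
    change ((f (h (Pi.single i 1)) • (Pi.single i 1 : Fin d → k)) i * x i) • g =
      f (h (x i • (Pi.single i 1 : Fin d → k))) • g
    simp [mul_comm]
  · intro i j hij f g
    ext h x
    simp [hij]

end RestrictBasis

/-- The map `restrictBasis` with values in the morphisms of `Γ^d P_k`. -/
def restrictHom (V : DivPow k d) :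
    TPow k d (V.carrier →ₗ[k] V.carrier) →ₗ[k] (ihom (std k d) V ⟶ ihom (std k d) V) :=
  restrictBasis V.carrier

theorem restrictHom_id (V : DivPow k d) :
    restrictHom V (PiTensorProduct.tprod k fun _ => LinearMap.id) =
      ihomHom (weightIdem k d) (𝟙 V) := by
  rw [weightIdem_eq_norm]
  exact restrictBasis_pure V.carrier LinearMap.id

theorem toStd_evalBasisDual (V : DivPow k d) (a : TPow k d (Module.Dual k V.carrier)) :
    toStd (ihom (std k d) V) (evalBasisDual V a) =
      TPow.norm k d _ (PiTensorProduct.map (evalRankOne V.carrier) a) :=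
  congrArg (TPow.norm k d (((Fin d → k) →ₗ[k] V.carrier) →ₗ[k] (Fin d → k)))
    (TPow.map_map (fun i => rankOne ((Fin d → k) →ₗ[k] V.carrier) (Fin d → k) (Pi.single i 1))
      (fun i => compL ((Fin d → k) →ₗ[k] V.carrier) V.carrier k
        (LinearMap.applyₗ (Pi.single i 1))) a)

theorem diagStd_comp_ihomHom_ofStd (V : DivPow k d) (t : TPow k d V.carrier) :
    diagStd k d ≫ ihomHom (𝟙 (std k d)) (ofStd V t) =
      TPow.norm k d _ (PiTensorProduct.map (diagRankOne V.carrier) t) := by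
  refine (congrArg (diagStd k d ≫ ·) (Gam.map₂_norm_right _ _ _)).trans
    ((Gam.map₂_norm_right _ _ _).trans (congrArg _ ?_))
  exact (congrArg (tmap₂ _ _) ((tmap₂_tprod_left _ _ _).trans (TPow.map_map _ _ _))).trans
    ((tmap₂_tprod_left _ _ _).trans (TPow.map_map _ _ _))

/-- The right side depends only on the tensor of endomorphisms attached to t ⊗ a. Summed over the
canonical element it becomes the action of the idempotent, by `restrictHom_id`. -/
theorem evalBasisDual_comp_diagStd_comp_ofStd (V : DivPow k d) (t : TPow k d V.carrier)
    (a : TPow k d (Module.Dual k V.carrier)) :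
    toStd _ (evalBasisDual V a) ≫ diagStd k d ≫ ihomHom (𝟙 (std k d)) (ofStd V t) =
      restrictHom V (tmap₂ (rankOne V.carrier V.carrier) t a) := by
  rw [toStd_evalBasisDual, diagStd_comp_ihomHom_ofStd]
  exact map₂_evalRankOne_diagRankOne V.carrier t a

/-! ### Coordinates of morphisms V ⊗ W ⟶ k^d -/

theorem tmap₂_tensL_dualPair {V V' W W' : Type u} [AddCommGroup V] [Module k V] [AddCommGroup V']
    [Module k V'] [AddCommGroup W] [Module k W] [AddCommGroup W'] [Module k W']
    (f : TPow k d (V →ₗ[k] V')) (g : TPow k d (W →ₗ[k] W')) (a : TPow k d (Module.Dual k V'))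
    (b : TPow k d (Module.Dual k W')) :
    tmap₂ (compL (V ⊗[k] W) (V' ⊗[k] W') k) (tmap₂ (tensL V V' W W') f g)
        (tmap₂ (dualPair V' W') a b) =
      tmap₂ (dualPair V W) (tmap₂ (compL V V' k) f a) (tmap₂ (compL W W' k) g b) := by
  apply tmap₂_interchange
  intro f g a b
  apply TensorProduct.ext'
  intro v w
  rfl

/-- The isomorphism `(V*)^{⊗ d} ⊗ (W*)^{⊗ d} ≃ ((V ⊗ W)*)^{⊗ d}`. -/
def dualTensEquiv (V W : DivPow k d) :
    TPow k d (Module.Dual k V.carrier) ⊗[k] TPow k d (Module.Dual k W.carrier) ≃ₗ[k]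
      TPow k d (Module.Dual k (tens V W).carrier) :=
  TPow.zipEquiv d (dualPair V.carrier W.carrier) (dualPair_bijective V.carrier W.carrier)

theorem dualEval_tensHom {V V' W W' : DivPow k d} (f : V ⟶ V') (g : W ⟶ W')
    (z : TPow k d (Module.Dual k V'.carrier) ⊗[k] TPow k d (Module.Dual k W'.carrier)) :
    dualEval (tensHom f g) (dualTensEquiv V' W' z) =
      dualTensEquiv V W (TensorProduct.map (dualEval f) (dualEval g) z) := by
  induction z with
  | zero => simp
  | add x y hx hy => simp only [map_add, hx, hy]
  | tmul a b => exact tmap₂_tensL_dualPair f.1 g.1 a b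

/-- The coordinates of a morphism `V ⊗ W ⟶ k^d`. -/
def tensCoords {V W : DivPow k d} : (tens V W ⟶ std k d) →ₗ[k]
    TPow k d (Module.Dual k V.carrier) ⊗[k] TPow k d (Module.Dual k W.carrier) :=
  (dualTensEquiv V W).symm.toLinearMap ∘ₗ coords

theorem tensCoords_tensHom_comp {V V' W W' : DivPow k d} (f : V ⟶ V') (g : W ⟶ W')
    (h : tens V' W' ⟶ std k d) :
    tensCoords (tensHom f g ≫ h) =
      TensorProduct.map (dualEval f) (dualEval g) (tensCoords h) := by
  change (dualTensEquiv V W).symm (coords (tensHom f g ≫ h)) = _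
  rw [LinearEquiv.symm_apply_eq, ← dualEval_tensHom, coords_comp]
  exact congrArg _ ((dualTensEquiv V' W').apply_symm_apply (coords h)).symm

theorem tensCoords_mulStd_comp_weightIdem :
    tensCoords (mulStd k d ≫ weightIdem k d) = coordTensor k d ⊗ₜ coordTensor k d := by
  change (dualTensEquiv _ _).symm (coords (mulStd k d ≫ weightIdem k d)) = _
  rw [LinearEquiv.symm_apply_eq, comp_weightIdem, coords_toStd, coords_mulStd]
  rfl

/-- The morphism `V ⊗ W ⟶ k^d` with given coordinates. -/
def ofTensCoords (V W : DivPow k d) :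
    TPow k d (Module.Dual k V.carrier) ⊗[k] TPow k d (Module.Dual k W.carrier) →ₗ[k]
      (tens V W ⟶ std k d) :=
  toStd (tens V W) ∘ₗ (dualTensEquiv V W).toLinearMap

/-- Coordinates see a morphism only up to the weight idempotent, which suffices since `ofValue`
absorbs that idempotent. -/
theorem ofTensCoords_tensCoords {V W : DivPow k d} (h : tens V W ⟶ std k d) :
    ofTensCoords V W (tensCoords h) = h ≫ weightIdem k d := by
  rw [comp_weightIdem]
  exact congrArg (toStd (tens V W)) ((dualTensEquiv V W).apply_symm_apply (coords h))

theorem ofTensCoords_tmul {V W : DivPow k d} (a : TPow k d (Module.Dual k V.carrier))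
    (b : TPow k d (Module.Dual k W.carrier)) :
    ofTensCoords V W (a ⊗ₜ b) = tensHom (toStd V a) (toStd W b) ≫ mulStd k d :=
  (tensHom_toStd_comp_mulStd a b).symm

end DivPow

/-! ### Sch(X) as a weight space of X(k^d) -/

namespace StrictPoly

open DivPow

variable {k : Type u} [CommRing k] {d : ℕ}

/-- The action of morphisms on the values of a strict polynomial functor, as a bilinear map. -/
def act (X : StrictPoly.{w, u} k d) (V W : DivPow k d) :
    (V ⟶ W) →ₗ[k] X.obj.obj V →ₗ[k] X.obj.obj W :=
  ModuleCat.homLinearEquiv (S := k).toLinearMap ∘ₗ X.obj.mapLinearMap k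

@[simp]
theorem act_apply (X : StrictPoly.{w, u} k d) {V W : DivPow k d} (f : V ⟶ W) (x : X.obj.obj V) :
    act X V W f x = X.obj.map f x := rfl

theorem map_comp_apply (X : StrictPoly.{w, u} k d) {U V W : DivPow k d} (f : U ⟶ V) (g : V ⟶ W)
    (x : X.obj.obj U) : X.obj.map (f ≫ g) x = X.obj.map g (X.obj.map f x) := by
  rw [X.obj.map_comp]
  rfl

theorem naturality_apply {X Y : StrictPoly.{w, u} k d} (f : X ⟶ Y) {V W : DivPow k d} (g : V ⟶ W)
    (x : X.obj.obj V) : f.hom.app W (X.obj.map g x) = Y.obj.map g (f.hom.app V x) :=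
  NatTrans.naturality_apply f.hom g x

/-- Evaluation of a morphism `⊗^d ⟶ X` at `t ∈ V^{⊗ d}`. -/
def evalAt (X : StrictPoly.{w, u} k d) (V : DivPow k d) :
    TPow k d V.carrier →ₗ[k] (tensorPower.{w, u} k d ⟶ X) →ₗ[k] X.obj.obj V :=
  LinearMap.mk₂ k (fun t α => α.hom.app V (ULift.up t))
    (fun t t' α => map_add (α.hom.app V).hom (ULift.up t) (ULift.up t'))
    (fun r t α => map_smul (α.hom.app V).hom r (ULift.up t))
    (fun _ _ _ => rfl) (fun _ _ _ => rfl)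

theorem hom_ext_evalAt {X : StrictPoly.{w, u} k d} {α β : tensorPower.{w, u} k d ⟶ X}
    (h : ∀ (V : DivPow k d) (t : TPow k d V.carrier), evalAt X V t α = evalAt X V t β) :
    α = β := by
  ext V t
  exact h V t.down

theorem map_evalAt {X : StrictPoly.{w, u} k d} {V W : DivPow k d} (f : V ⟶ W)
    (t : TPow k d V.carrier) (α : tensorPower.{w, u} k d ⟶ X) :
    X.obj.map f (evalAt X V t α) = evalAt X W (evalL V W f t) α :=
  (naturality_apply α f (ULift.up t)).symm

theorem evalAt_schRep {X : StrictPoly.{w, u} k d} {V : DivPow k d} (t : TPow k d V.carrier)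
    (σ : Equiv.Perm (Fin d)) (α : tensorPower.{w, u} k d ⟶ X) :
    evalAt X V t (schRep X σ α) = evalAt X V (permRep k d _ σ⁻¹ t) α := rfl

theorem evalAt_comp {X Y : StrictPoly.{w, u} k d} {V : DivPow k d} (t : TPow k d V.carrier)
    (α : tensorPower.{w, u} k d ⟶ X) (f : X ⟶ Y) :
    evalAt Y V t (α ≫ f) = f.hom.app V (evalAt X V t α) := rfl

/-- Evaluation of a morphism `⊗^d ⟶ X` at `e_1 ⊗ ⋯ ⊗ e_d`. -/
def evalBasis (X : StrictPoly.{w, u} k d) :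
    (tensorPower.{w, u} k d ⟶ X) →ₗ[k] X.obj.obj (std k d) :=
  evalAt X (std k d) (basisTensor k d)

/-- The morphism `⊗^d ⟶ X` defined by an element of `X(k^d)`. -/
def ofValue (X : StrictPoly.{w, u} k d) :
    X.obj.obj (std k d) →ₗ[k] (tensorPower.{w, u} k d ⟶ X) where
  toFun x := ObjectProperty.homMk
    { app V := ModuleCat.ofHom ((act X (std k d) V).flip x ∘ₗ ofStd V ∘ₗ
        (ULift.moduleEquiv (R := k) (M := TPow k d V.carrier)).toLinearMap)
      naturality V W f := by
        ext t
        exact (congrArg (fun g => X.obj.map g x) (ofStd_comp t.down f).symm).trans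
          (map_comp_apply X _ _ x) }
  map_add' x y := by
    ext V t
    exact map_add (X.obj.map (ofStd V t.down)).hom x y
  map_smul' r x := by
    ext V t
    exact map_smul (X.obj.map (ofStd V t.down)).hom r x

theorem evalAt_ofValue {X : StrictPoly.{w, u} k d} {V : DivPow k d} (t : TPow k d V.carrier)
    (x : X.obj.obj (std k d)) : evalAt X V t (ofValue X x) = X.obj.map (ofStd V t) x := rfl

theorem evalBasis_ofValue {X : StrictPoly.{w, u} k d} (x : X.obj.obj (std k d)) :
    evalBasis X (ofValue X x) = X.obj.map (weightIdem k d) x := rfl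

/-- Yoneda argument: t is the image of e_1 ⊗ ⋯ ⊗ e_d under `ofStd V t`, so naturality determines
α(t) from its value on the basis tensor. -/
theorem ofValue_evalBasis {X : StrictPoly.{w, u} k d} (α : tensorPower.{w, u} k d ⟶ X) :
    ofValue X (evalBasis X α) = α :=
  hom_ext_evalAt fun V t => by
    rw [evalAt_ofValue, evalBasis, map_evalAt, evalL_ofStd]

theorem ofValue_map_weightIdem {X : StrictPoly.{w, u} k d} (x : X.obj.obj (std k d)) :
    ofValue X (X.obj.map (weightIdem k d) x) = ofValue X x := by
  rw [← evalBasis_ofValue, ofValue_evalBasis]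

theorem map_weightIdem_evalBasis {X : StrictPoly.{w, u} k d} (α : tensorPower.{w, u} k d ⟶ X) :
    X.obj.map (weightIdem k d) (evalBasis X α) = evalBasis X α := by
  rw [← evalBasis_ofValue, ofValue_evalBasis]

theorem evalBasis_comp {X Y : StrictPoly.{w, u} k d} (α : tensorPower.{w, u} k d ⟶ X)
    (f : X ⟶ Y) : evalBasis Y (α ≫ f) = f.hom.app (std k d) (evalBasis X α) := rfl

theorem ofValue_app {X Y : StrictPoly.{w, u} k d} (f : X ⟶ Y) (x : X.obj.obj (std k d)) :
    ofValue Y (f.hom.app (std k d) x) = ofValue X x ≫ f :=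
  hom_ext_evalAt fun V t => by
    rw [evalAt_ofValue, evalAt_comp, evalAt_ofValue, naturality_apply]

theorem evalBasis_schRep {X : StrictPoly.{w, u} k d} (σ : Equiv.Perm (Fin d))
    (α : tensorPower.{w, u} k d ⟶ X) :
    evalBasis X (schRep X σ α) = X.obj.map (permStd k σ) (evalBasis X α) := by
  rw [evalBasis, evalAt_schRep, map_evalAt, evalL_permStd]

theorem ofValue_map_permStd {X : StrictPoly.{w, u} k d} (σ : Equiv.Perm (Fin d))
    (x : X.obj.obj (std k d)) :
    ofValue X (X.obj.map (permStd k σ) x) = schRep X σ (ofValue X x) :=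
  hom_ext_evalAt fun V t => by
    rw [evalAt_schRep, evalAt_ofValue, evalAt_ofValue, ← map_comp_apply, permStd_comp_ofStd]

/-- The bilinear map `(x, a) ↦ X(toStd a) x`, followed by `X(k^d) → Sch(X)`. -/
def coordAct (X : StrictPoly.{w, u} k d) (V : DivPow k d) :
    X.obj.obj V →ₗ[k] TPow k d (Module.Dual k V.carrier) →ₗ[k] (tensorPower.{w, u} k d ⟶ X) :=
  ((act X V (std k d) ∘ₗ toStd V).flip).compr₂ (ofValue X)

theorem coordAct_apply {X : StrictPoly.{w, u} k d} {V : DivPow k d} (x : X.obj.obj V)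
    (a : TPow k d (Module.Dual k V.carrier)) :
    coordAct X V x a = ofValue X (X.obj.map (toStd V a) x) := rfl

theorem coordAct_map {X : StrictPoly.{w, u} k d} {V W : DivPow k d} (f : V ⟶ W)
    (x : X.obj.obj V) : coordAct X W (X.obj.map f x) = coordAct X V x ∘ₗ dualEval f := by
  refine LinearMap.ext fun a => ?_
  rw [LinearMap.comp_apply, coordAct_apply, coordAct_apply, ← map_comp_apply, comp_toStd]

theorem evalBasis_coordAct {X : StrictPoly.{w, u} k d} {V : DivPow k d} (x : X.obj.obj V)
    (a : TPow k d (Module.Dual k V.carrier)) :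
    evalBasis X (coordAct X V x a) = X.obj.map (toStd V a) x := by
  rw [coordAct_apply, evalBasis_ofValue, ← map_comp_apply, toStd_comp_weightIdem]

/-- The coordinate tensor gives the weight idempotent, which fixes the value of α on the basis
tensor. -/
theorem coordAct_coordTensor {X : StrictPoly.{w, u} k d} (α : tensorPower.{w, u} k d ⟶ X) :
    coordAct X (std k d) (evalBasis X α) (coordTensor k d) = α := by
  rw [coordAct_apply, ← weightIdem_eq, map_weightIdem_evalBasis, ofValue_evalBasis]

/-! ### The Schur functor and internal tensor products -/

section Day

variable (X Y : StrictPoly.{w, u} k d)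

/-- The class of `h ⊗ x ⊗ y`, as a bilinear map in `x` and `y`. -/
def dayMkBilin (U V W : DivPow k d) (h : tens V W ⟶ U) :
    X.obj.obj V →ₗ[k] Y.obj.obj W →ₗ[k] DayMod X Y U :=
  LinearMap.mk₂ k (dayMk X Y U V W h)
    (fun x x' y => by
      simp only [dayMk, dayGen, TensorProduct.add_tmul, TensorProduct.tmul_add, map_add])
    (fun r x y => by
      simp only [dayMk, dayGen, ← TensorProduct.smul_tmul', TensorProduct.tmul_smul, map_smul])
    (fun x y y' => by simp only [dayMk, dayGen, TensorProduct.tmul_add, map_add])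
    (fun r x y => by simp only [dayMk, dayGen, TensorProduct.tmul_smul, map_smul])

theorem dayMk_tensHom_comp {U V V' W W' : DivPow k d} (f : V ⟶ V') (g : W ⟶ W')
    (h : tens V' W' ⟶ U) (x : X.obj.obj V) (y : Y.obj.obj W) :
    dayMk X Y U V W (tensHom f g ≫ h) x y =
      dayMk X Y U V' W' h (X.obj.map f x) (Y.obj.map g y) := by
  refine (Submodule.Quotient.eq _).2 (Submodule.subset_span ⟨V, V', W, W', f, g, h, x, y, rfl⟩)

variable {X Y} in
open Classical in
/-- The linear map on generators of the coend defined by a family of trilinear maps. -/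
def dayGenLift {U : DivPow k d} {M : Type*} [AddCommGroup M] [Module k M]
    (G : ∀ V W : DivPow k d, X.obj.obj V →ₗ[k] Y.obj.obj W →ₗ[k] (tens V W ⟶ U) →ₗ[k] M) :
    DayGen X Y U →ₗ[k] M :=
  DirectSum.toModule k _ M fun p => TensorProduct.lift (TensorProduct.lift (G p.1 p.2)).flip

open Classical in
theorem dayGenLift_dayGen {U : DivPow k d} {M : Type*} [AddCommGroup M] [Module k M]
    (G : ∀ V W : DivPow k d, X.obj.obj V →ₗ[k] Y.obj.obj W →ₗ[k] (tens V W ⟶ U) →ₗ[k] M)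
    (V W : DivPow k d) (h : tens V W ⟶ U) (x : X.obj.obj V) (y : Y.obj.obj W) :
    dayGenLift G (dayGen X Y U V W h x y) = G V W x y h := by
  refine (DirectSum.toModule_lof k _ _).trans ?_
  rfl

variable {X Y} in
/-- The universal property of the coend. -/
def dayLift {U : DivPow k d} {M : Type*} [AddCommGroup M] [Module k M]
    (G : ∀ V W : DivPow k d, X.obj.obj V →ₗ[k] Y.obj.obj W →ₗ[k] (tens V W ⟶ U) →ₗ[k] M)
    (hG : ∀ (V V' W W' : DivPow k d) (f : V ⟶ V') (g : W ⟶ W') (h : tens V' W' ⟶ U)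
      (x : X.obj.obj V) (y : Y.obj.obj W),
      G V W x y (tensHom f g ≫ h) = G V' W' (X.obj.map f x) (Y.obj.map g y) h) :
    DayMod X Y U →ₗ[k] M :=
  (dayRel X Y U).liftQ (dayGenLift G) (by
    refine Submodule.span_le.2 ?_
    rintro _ ⟨V, V', W, W', f, g, h, x, y, rfl⟩
    rw [SetLike.mem_coe, LinearMap.mem_ker, map_sub, sub_eq_zero, dayGenLift_dayGen,
      dayGenLift_dayGen, hG])

theorem dayLift_dayMk {U : DivPow k d} {M : Type*} [AddCommGroup M] [Module k M]
    (G : ∀ V W : DivPow k d, X.obj.obj V →ₗ[k] Y.obj.obj W →ₗ[k] (tens V W ⟶ U) →ₗ[k] M)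
    (hG) (V W : DivPow k d) (h : tens V W ⟶ U) (x : X.obj.obj V) (y : Y.obj.obj W) :
    dayLift G hG (dayMk X Y U V W h x y) = G V W x y h :=
  dayGenLift_dayGen X Y G V W h x y

end Day

section Day

variable (X Y : StrictPoly.{w, u} k d)

/-- Evaluation of a morphism `⊗^d ⟶ X ⊗_int Y` at `e_1 ⊗ ⋯ ⊗ e_d`. -/
def dayEvalBasis : (tensorPower.{w, u} k d ⟶ internalTensorObj X Y) →ₗ[k] DayMod X Y (std k d) :=
  evalBasis (internalTensorObj X Y)

/-- The morphism `⊗^d ⟶ X ⊗_int Y` defined by an element of `(X ⊗_int Y)(k^d)`. -/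
def dayOfValue : DayMod X Y (std k d) →ₗ[k] (tensorPower.{w, u} k d ⟶ internalTensorObj X Y) :=
  ofValue (internalTensorObj X Y)

theorem dayOfValue_dayEvalBasis (γ : tensorPower.{w, u} k d ⟶ internalTensorObj X Y) :
    dayOfValue X Y (dayEvalBasis X Y γ) = γ := ofValue_evalBasis γ

theorem dayEvalBasis_dayOfValue (z : DayMod X Y (std k d)) :
    dayEvalBasis X Y (dayOfValue X Y z) = dayMap (𝟙 X) (𝟙 Y) (weightIdem k d) z := rfl

theorem dayOfValue_dayMap_weightIdem (z : DayMod X Y (std k d)) :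
    dayOfValue X Y (dayMap (𝟙 X) (𝟙 Y) (weightIdem k d) z) = dayOfValue X Y z :=
  ofValue_map_weightIdem (X := internalTensorObj X Y) z

theorem dayOfValue_dayMap_permStd (σ : Equiv.Perm (Fin d)) (z : DayMod X Y (std k d)) :
    dayOfValue X Y (dayMap (𝟙 X) (𝟙 Y) (permStd k σ) z) =
      schRep (internalTensorObj X Y) σ (dayOfValue X Y z) :=
  ofValue_map_permStd (X := internalTensorObj X Y) σ z

/-- The morphism of internal tensor products induced by morphisms of both factors. -/
def dayNat {P Q : StrictPoly.{w, u} k d × StrictPoly.{w, u} k d} (f : P ⟶ Q) :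
    internalTensorObj P.1 P.2 ⟶ internalTensorObj Q.1 Q.2 :=
  (internalTensor k d).map f

theorem dayOfValue_dayMap {P Q : StrictPoly.{w, u} k d × StrictPoly.{w, u} k d} (f : P ⟶ Q)
    (z : DayMod P.1 P.2 (std k d)) :
    dayOfValue Q.1 Q.2 (dayMap f.1 f.2 (𝟙 _) z) = dayOfValue P.1 P.2 z ≫ dayNat f :=
  ofValue_app (dayNat f) z

theorem dayMap_id_dayMk {U U' : DivPow k d} (f : U ⟶ U') (V W : DivPow k d)
    (h : tens V W ⟶ U) (x : X.obj.obj V) (y : Y.obj.obj W) :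
    dayMap (𝟙 X) (𝟙 Y) f (dayMk X Y U V W h x y) = dayMk X Y U' V W (h ≫ f) x y :=
  dayMap_dayMk _ _ _ _ _ _ _ _

/-- The map `X(k^d) ⊗ Y(k^d) → (X ⊗_int Y)(k^d)` given by the multiplication of `k^d`. -/
def mulValue : X.obj.obj (std k d) ⊗[k] Y.obj.obj (std k d) →ₗ[k] DayMod X Y (std k d) :=
  TensorProduct.lift (dayMkBilin X Y (std k d) (std k d) (std k d) (mulStd k d))

/-- The comparison map `Sch(X) ⊗ Sch(Y) → Sch(X ⊗_int Y)`. -/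
def schTensorInv : (tensorPower.{w, u} k d ⟶ X) ⊗[k] (tensorPower.{w, u} k d ⟶ Y) →ₗ[k]
    (tensorPower.{w, u} k d ⟶ internalTensorObj X Y) :=
  dayOfValue X Y ∘ₗ mulValue X Y ∘ₗ
    TensorProduct.map (evalBasis X) (evalBasis Y)

theorem schTensorInv_tmul (α : tensorPower.{w, u} k d ⟶ X) (β : tensorPower.{w, u} k d ⟶ Y) :
    schTensorInv X Y (α ⊗ₜ β) = dayOfValue X Y
      (dayMk X Y (std k d) (std k d) (std k d) (mulStd k d) (evalBasis X α) (evalBasis Y β)) := rfl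

/-- The map `(X ⊗_int Y)(k^d) → Sch(X) ⊗ Sch(Y)` which sends the class of `h ⊗ x ⊗ y` to
`∑ X(f_i) x ⊗ Y(g_i) y` if the coordinates of `h` are `∑ f_i ⊗ g_i`. -/
def splitValue : DayMod X Y (std k d) →ₗ[k]
    (tensorPower.{w, u} k d ⟶ X) ⊗[k] (tensorPower.{w, u} k d ⟶ Y) :=
  dayLift (fun V W => ((TensorProduct.mapBilinear (RingHom.id k) _ _ _ _).compl₁₂
      (coordAct X V) (coordAct Y W)).compr₂
      (LinearMap.lcomp k _ (tensCoords (V := V) (W := W))))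
    (fun V V' W W' f g h x y => by
      change TensorProduct.map (coordAct X V x) (coordAct Y W y) (tensCoords (tensHom f g ≫ h)) =
        TensorProduct.map (coordAct X V' (X.obj.map f x)) (coordAct Y W' (Y.obj.map g y))
          (tensCoords h)
      rw [tensCoords_tensHom_comp, coordAct_map, coordAct_map, TensorProduct.map_comp]
      rfl)

theorem splitValue_dayMk (V W : DivPow k d) (h : tens V W ⟶ std k d) (x : X.obj.obj V)
    (y : Y.obj.obj W) : splitValue X Y (dayMk X Y (std k d) V W h x y) =
      TensorProduct.map (coordAct X V x) (coordAct Y W y) (tensCoords h) :=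
  dayLift_dayMk X Y _ _ V W h x y

/-- The multiplication of k^d followed by the idempotent has the single pure tensor of coordinate
tensors as coordinates, and these act trivially on α and β. -/
theorem splitValue_schTensorInv
    (z : (tensorPower.{w, u} k d ⟶ X) ⊗[k] (tensorPower.{w, u} k d ⟶ Y)) :
    splitValue X Y (dayEvalBasis X Y (schTensorInv X Y z)) = z := by
  induction z with
  | zero => simp
  | add x y hx hy => simp only [map_add, hx, hy]
  | tmul α β =>
    rw [schTensorInv_tmul, dayEvalBasis_dayOfValue, dayMap_id_dayMk, splitValue_dayMk,
      tensCoords_mulStd_comp_weightIdem, TensorProduct.map_tmul, coordAct_coordTensor,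
      coordAct_coordTensor]

/-- For a class h ⊗ x ⊗ y, the morphism h ≫ e is a sum of products of morphisms from V and W to k^d;
the coend relation moves these onto x and y. -/
theorem schTensorInv_splitValue (z : DayMod X Y (std k d)) :
    schTensorInv X Y (splitValue X Y z) = dayOfValue X Y z := by
  refine LinearMap.congr_fun (f := schTensorInv X Y ∘ₗ splitValue X Y)
    (g := dayOfValue X Y) (dayMod_ext fun V W h x y => ?_) z
  have key (c : TPow k d (Module.Dual k V.carrier) ⊗[k] TPow k d (Module.Dual k W.carrier)) :
      schTensorInv X Y (TensorProduct.map (coordAct X V x) (coordAct Y W y) c) =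
        dayOfValue X Y (dayMk X Y (std k d) V W (ofTensCoords V W c) x y) := by
    induction c with
    | zero =>
      have h0 : dayMk X Y (std k d) V W 0 x y = 0 := by
        simpa using dayMk_smul (0 : k) (0 : tens V W ⟶ std k d) x y
      simp only [map_zero, h0]
    | add c c' hc hc' => simp only [map_add, dayMk_add, hc, hc']
    | tmul a b =>
      rw [TensorProduct.map_tmul, schTensorInv_tmul, evalBasis_coordAct, evalBasis_coordAct,
        ofTensCoords_tmul, dayMk_tensHom_comp]
  rw [LinearMap.comp_apply, splitValue_dayMk, key, ofTensCoords_tensCoords,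
    ← dayMap_id_dayMk]
  exact dayOfValue_dayMap_weightIdem X Y _

/-- The isomorphism `Sch(X ⊗_int Y) ≃ Sch(X) ⊗ Sch(Y)` of `k`-modules. -/
def schTensorEquiv : (tensorPower.{w, u} k d ⟶ internalTensorObj X Y) ≃ₗ[k]
    (tensorPower.{w, u} k d ⟶ X) ⊗[k] (tensorPower.{w, u} k d ⟶ Y) :=
  (LinearEquiv.ofLinearMap (schTensorInv X Y)
    (splitValue X Y ∘ₗ dayEvalBasis X Y)
    (LinearMap.ext fun γ => by
      rw [LinearMap.comp_apply, LinearMap.comp_apply, schTensorInv_splitValue,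
        dayOfValue_dayEvalBasis, LinearMap.id_apply])
    (LinearMap.ext fun z => splitValue_schTensorInv X Y z)).symm

/-- The diagonal action becomes the action of σ on k^d because σ commutes with multiplication. -/
theorem schTensorInv_schRep (σ : Equiv.Perm (Fin d)) :
    schTensorInv X Y ∘ₗ (schRep X).tprod (schRep Y) σ =
      schRep (internalTensorObj X Y) σ ∘ₗ schTensorInv X Y := by
  apply TensorProduct.ext'
  intro α β
  simp only [LinearMap.comp_apply, Representation.tprod_apply, TensorProduct.map_tmul]
  rw [schTensorInv_tmul, schTensorInv_tmul, evalBasis_schRep, evalBasis_schRep,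
    ← dayMk_tensHom_comp, tensHom_permStd_comp_mulStd, ← dayMap_id_dayMk]
  exact dayOfValue_dayMap_permStd X Y σ _

theorem schTensorInv_comp {P Q : StrictPoly.{w, u} k d × StrictPoly.{w, u} k d} (f : P ⟶ Q)
    (α : tensorPower.{w, u} k d ⟶ P.1) (β : tensorPower.{w, u} k d ⟶ P.2) :
    schTensorInv Q.1 Q.2 ((α ≫ f.1) ⊗ₜ (β ≫ f.2)) =
      schTensorInv P.1 P.2 (α ⊗ₜ β) ≫ dayNat f := by
  rw [schTensorInv_tmul, schTensorInv_tmul, evalBasis_comp, evalBasis_comp, ← dayOfValue_dayMap,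
    dayMap_dayMk, Category.comp_id]

end Day

/-- The Schur functor takes the internal tensor product to the Kronecker tensor product. -/
def schTensorIso (k : Type u) [CommRing k] (d : ℕ) :
    (Sch.{w, u} k d).prod (Sch.{w, u} k d) ⋙ kron.{w, u} k (Equiv.Perm (Fin d)) ≅
      internalTensor.{w, u} k d ⋙ Sch.{w, u} k d :=
  NatIso.ofComponents
    (fun P => Rep.mkIso (.mk (schTensorEquiv P.1 P.2).symm
      (fun σ => schTensorInv_schRep P.1 P.2 σ)))
    (fun {P Q} f => by
      ext1
      ext1
      refine TensorProduct.ext' fun α β => ?_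
      exact schTensorInv_comp f α β)

/-! ### The Schur functor and internal Hom -/

/-- The map `W^{⊗ d} ⊗ (V*)^{⊗ d} → Y(W)`, `t ⊗ a ↦ ψ(a)(t)`. -/
def contract {Y : StrictPoly.{w, u} k d} {V : DivPow k d}
    (ψ : TPow k d (Module.Dual k V.carrier) →ₗ[k] (tensorPower.{w, u} k d ⟶ Y)) (W : DivPow k d) :
    TPow k d W.carrier ⊗[k] TPow k d (Module.Dual k V.carrier) →ₗ[k] Y.obj.obj W :=
  TensorProduct.lift ((evalAt Y W).compl₂ ψ)

theorem contract_tmul {Y : StrictPoly.{w, u} k d} {V : DivPow k d}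
    (ψ : TPow k d (Module.Dual k V.carrier) →ₗ[k] (tensorPower.{w, u} k d ⟶ Y)) {W : DivPow k d}
    (t : TPow k d W.carrier) (a : TPow k d (Module.Dual k V.carrier)) :
    contract ψ W (t ⊗ₜ a) = evalAt Y W t (ψ a) := rfl

theorem contract_rTensor {Y : StrictPoly.{w, u} k d} {V W W' : DivPow k d}
    (ψ : TPow k d (Module.Dual k V.carrier) →ₗ[k] (tensorPower.{w, u} k d ⟶ Y)) (f : W ⟶ W')
    (z : TPow k d W.carrier ⊗[k] TPow k d (Module.Dual k V.carrier)) :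
    contract ψ W' ((evalL W W' f).rTensor _ z) = Y.obj.map f (contract ψ W z) := by
  induction z with
  | zero => simp
  | add x y hx hy => simp only [map_add, hx, hy]
  | tmul t a => exact (map_evalAt f t (ψ a)).symm

theorem contract_lTensor {Y : StrictPoly.{w, u} k d} {V V' W : DivPow k d}
    (ψ : TPow k d (Module.Dual k V.carrier) →ₗ[k] (tensorPower.{w, u} k d ⟶ Y))
    (f : TPow k d (Module.Dual k V'.carrier) →ₗ[k] TPow k d (Module.Dual k V.carrier))
    (z : TPow k d W.carrier ⊗[k] TPow k d (Module.Dual k V'.carrier)) :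
    contract ψ W (f.lTensor _ z) = contract (ψ ∘ₗ f) W z := by
  induction z with
  | zero => simp
  | add x y hx hy => simp only [map_add, hx, hy]
  | tmul t a => rfl

/-- If ∑ t_j ⊗ a_j is the canonical element, the contraction is β(∑ ⟨a_j, u⟩ t_j), and that sum is
u. -/
theorem contract_coev_of_pairing {Y : StrictPoly.{w, u} k d} {V : DivPow k d}
    (ψ : TPow k d (Module.Dual k V.carrier) →ₗ[k] (tensorPower.{w, u} k d ⟶ Y))
    (u : TPow k d V.carrier) (β : tensorPower.{w, u} k d ⟶ Y)
    (h : ∀ a, ψ a = pairing V a u • β) :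
    contract ψ V (coev V) = evalAt Y V u β := by
  have key (z : TPow k d V.carrier ⊗[k] TPow k d (Module.Dual k V.carrier)) :
      contract ψ V z = evalAt Y V (TensorProduct.rid k _ (((pairing V).flip u).lTensor _ z)) β := by
    induction z with
    | zero => simp
    | add x y hx hy => simp only [map_add, LinearMap.add_apply, hx, hy]
    | tmul t a => simp [contract_tmul, h]
  rw [key, pairing_coev]

section Hom

variable (X Y : StrictPoly.{w, u} k d)

/-- Evaluation of a morphism `⊗^d ⟶ ℍ(X, Y)` at `e_1 ⊗ ⋯ ⊗ e_d`. -/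
def homEvalBasis : (tensorPower.{w, u} k d ⟶ internalHomObj X Y) →ₗ[k] (param X (std k d) ⟶ Y) :=
  evalBasis (internalHomObj X Y)

/-- The morphism `⊗^d ⟶ ℍ(X, Y)` defined by an element of `ℍ(X, Y)(k^d)`. -/
def homOfValue : (param X (std k d) ⟶ Y) →ₗ[k] (tensorPower.{w, u} k d ⟶ internalHomObj X Y) :=
  ofValue (internalHomObj X Y)

theorem homOfValue_homEvalBasis (γ : tensorPower.{w, u} k d ⟶ internalHomObj X Y) :
    homOfValue X Y (homEvalBasis X Y γ) = γ := ofValue_evalBasis γ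

theorem homEvalBasis_homOfValue (α : param X (std k d) ⟶ Y) :
    homEvalBasis X Y (homOfValue X Y α) = homMap (𝟙 X) (𝟙 Y) (weightIdem k d) α := rfl

theorem homOfValue_homMap_weightIdem (α : param X (std k d) ⟶ Y) :
    homOfValue X Y (homMap (𝟙 X) (𝟙 Y) (weightIdem k d) α) = homOfValue X Y α :=
  ofValue_map_weightIdem (X := internalHomObj X Y) α

theorem homEvalBasis_schRep (σ : Equiv.Perm (Fin d))
    (γ : tensorPower.{w, u} k d ⟶ internalHomObj X Y) :
    homEvalBasis X Y (schRep _ σ γ) =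
      homMap (𝟙 X) (𝟙 Y) (permStd k σ) (homEvalBasis X Y γ) :=
  evalBasis_schRep (X := internalHomObj X Y) σ γ

/-- The morphism of internal Hom objects induced by morphisms of both arguments. -/
def homNat {P Q : (StrictPoly.{w, u} k d)ᵒᵖ × StrictPoly.{w, u} k d} (f : P ⟶ Q) :
    internalHomObj P.1.unop P.2 ⟶ internalHomObj Q.1.unop Q.2 :=
  (internalHom k d).map f

theorem homEvalBasis_comp {P Q : (StrictPoly.{w, u} k d)ᵒᵖ × StrictPoly.{w, u} k d} (f : P ⟶ Q)
    (γ : tensorPower.{w, u} k d ⟶ internalHomObj P.1.unop P.2) :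
    homEvalBasis _ _ (γ ≫ homNat f) =
      homMap f.1.unop f.2 (𝟙 (std k d)) (homEvalBasis _ _ γ) := rfl

variable {X Y} in
theorem homMap_app_apply {X' Y' : StrictPoly.{w, u} k d} {U U' : DivPow k d} (g : X' ⟶ X)
    (h : Y ⟶ Y') (f : U ⟶ U') (α : param X U ⟶ Y) (V : DivPow k d)
    (x : X'.obj.obj (ihom U' V)) :
    (homMap g h f α).hom.app V x =
      h.hom.app V (α.hom.app V (g.hom.app (ihom U V) (X'.obj.map (ihomHom f (𝟙 V)) x))) := rfl

variable {X Y} in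
theorem param_naturality_apply {U V W : DivPow k d} (α : param X U ⟶ Y) (f : V ⟶ W)
    (x : X.obj.obj (ihom U V)) :
    α.hom.app W (X.obj.map (ihomHom (𝟙 U) f) x) = Y.obj.map f (α.hom.app V x) :=
  naturality_apply α f x

/-- The map `Hom(X^{k^d}, Y) → Hom(Sch(X), Sch(Y))` given by the diagonal of `k^d`. -/
def diagValue : (param X (std k d) ⟶ Y) →ₗ[k]
    (tensorPower.{w, u} k d ⟶ X) →ₗ[k] (tensorPower.{w, u} k d ⟶ Y) :=
  LinearMap.mk₂ k
    (fun α ξ => ofValue Y (α.hom.app (std k d) (X.obj.map (diagStd k d) (evalBasis X ξ))))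
    (fun α β ξ => map_add (ofValue Y) _ _)
    (fun r α ξ => map_smul (ofValue Y) r _)
    (fun α ξ ζ => by
      rw [map_add, map_add, ← map_add (ofValue Y)]
      exact congrArg _ (map_add (α.hom.app (std k d)).hom _ _))
    (fun r α ξ => by
      rw [map_smul, map_smul, ← map_smul (ofValue Y)]
      exact congrArg _ (map_smul (α.hom.app (std k d)).hom _ _))

variable {X Y} in
theorem diagValue_apply (α : param X (std k d) ⟶ Y) (ξ : tensorPower.{w, u} k d ⟶ X) :
    diagValue X Y α ξ =
      ofValue Y (α.hom.app (std k d) (X.obj.map (diagStd k d) (evalBasis X ξ))) := rfl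

variable {X Y} in
/-- The family of elements of `Sch(Y)` attached to a linear map `Sch(X) → Sch(Y)` and an element
of `X(Hom(k^d, V))`. -/
def coordFamily (φ : (tensorPower.{w, u} k d ⟶ X) →ₗ[k] (tensorPower.{w, u} k d ⟶ Y))
    {V : DivPow k d} (x : X.obj.obj (ihom (std k d) V)) :
    TPow k d (Module.Dual k V.carrier) →ₗ[k] (tensorPower.{w, u} k d ⟶ Y) :=
  φ ∘ₗ coordAct X (ihom (std k d) V) x ∘ₗ evalBasisDual V

variable {X Y} in
theorem coordFamily_apply (φ : (tensorPower.{w, u} k d ⟶ X) →ₗ[k] (tensorPower.{w, u} k d ⟶ Y))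
    {V : DivPow k d} (x : X.obj.obj (ihom (std k d) V))
    (a : TPow k d (Module.Dual k V.carrier)) :
    coordFamily φ x a = φ (ofValue X (X.obj.map (toStd _ (evalBasisDual V a)) x)) := rfl

variable {X Y} in
theorem coordFamily_map (φ : (tensorPower.{w, u} k d ⟶ X) →ₗ[k] (tensorPower.{w, u} k d ⟶ Y))
    {V W : DivPow k d} (f : V ⟶ W) (x : X.obj.obj (ihom (std k d) V)) :
    coordFamily φ (X.obj.map (ihomHom (𝟙 (std k d)) f) x) = coordFamily φ x ∘ₗ dualEval f := by
  refine LinearMap.ext fun a => ?_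
  rw [LinearMap.comp_apply, coordFamily_apply, coordFamily_apply, ← map_comp_apply,
    ihomHom_comp_evalBasisDual]

variable {X Y} in
/-- The value at `V` of the morphism `X^{k^d} ⟶ Y` attached to a linear map `Sch(X) → Sch(Y)`. -/
def undiagValue (φ : (tensorPower.{w, u} k d ⟶ X) →ₗ[k] (tensorPower.{w, u} k d ⟶ Y))
    (V : DivPow k d) : X.obj.obj (ihom (std k d) V) →ₗ[k] Y.obj.obj V where
  toFun x := contract (coordFamily φ x) V (coev V)
  map_add' x y := by
    -- Additivity in x holds for contraction with every tensor, hence can be tested on pure ones.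
    refine LinearMap.congr_fun (g := contract (coordFamily φ x) V + contract (coordFamily φ y) V)
      (TensorProduct.ext' fun t a => ?_) _
    simp only [LinearMap.add_apply, contract_tmul, coordFamily, LinearMap.comp_apply, map_add]
  map_smul' r x := by
    refine LinearMap.congr_fun (g := r • contract (coordFamily φ x) V)
      (TensorProduct.ext' fun t a => ?_) _
    simp only [LinearMap.smul_apply, contract_tmul, coordFamily, LinearMap.comp_apply, map_smul]

variable {X Y} in
theorem undiagValue_map (φ : (tensorPower.{w, u} k d ⟶ X) →ₗ[k] (tensorPower.{w, u} k d ⟶ Y))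
    {V W : DivPow k d} (f : V ⟶ W) (x : X.obj.obj (ihom (std k d) V)) :
    undiagValue φ W (X.obj.map (ihomHom (𝟙 (std k d)) f) x) =
      Y.obj.map f (undiagValue φ V x) := by
  change contract (coordFamily φ (X.obj.map (ihomHom (𝟙 (std k d)) f) x)) W (coev W) =
    Y.obj.map f (contract (coordFamily φ x) V (coev V))
  rw [coordFamily_map, ← contract_lTensor, ← map_coev, contract_rTensor]

variable {X Y} in
/-- The morphism `X^{k^d} ⟶ Y` attached to a linear map `Sch(X) → Sch(Y)`. -/
def undiag (φ : (tensorPower.{w, u} k d ⟶ X) →ₗ[k] (tensorPower.{w, u} k d ⟶ Y)) :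
    param X (std k d) ⟶ Y :=
  ObjectProperty.homMk
    { app V := ModuleCat.ofHom (undiagValue φ V)
      naturality V W f := by
        ext x
        exact undiagValue_map φ f x }

variable {X Y} in
theorem undiag_app_apply (φ : (tensorPower.{w, u} k d ⟶ X) →ₗ[k] (tensorPower.{w, u} k d ⟶ Y))
    {V : DivPow k d} (x : X.obj.obj (ihom (std k d) V)) :
    (undiag φ).hom.app V x = contract (coordFamily φ x) V (coev V) := rfl

/-- On diagonal elements the family a ↦ φ(a x) is ⟨a, e_1 ⊗ ⋯ ⊗ e_d⟩ φ(ξ), so contraction returns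
the value of φ(ξ) at the basis tensor. -/
theorem diagValue_undiag (φ : (tensorPower.{w, u} k d ⟶ X) →ₗ[k] (tensorPower.{w, u} k d ⟶ Y)) :
    diagValue X Y (undiag φ) = φ := by
  refine LinearMap.ext fun ξ => ?_
  rw [diagValue_apply, undiag_app_apply,
    contract_coev_of_pairing _ (basisTensor k d) (φ ξ) fun a => ?_]
  · exact ofValue_evalBasis (φ ξ)
  · rw [coordFamily_apply, ← map_comp_apply, diagStd_comp_evalBasisDual, ← act_apply, map_smul,
      LinearMap.smul_apply, map_smul, map_smul, act_apply, map_weightIdem_evalBasis,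
      ofValue_evalBasis]

variable {X Y} in
/-- The value at `V` of a morphism `X^U ⟶ Y`. -/
def paramApp {U : DivPow k d} (α : param X U ⟶ Y) (V : DivPow k d) :
    X.obj.obj (ihom U V) →ₗ[k] Y.obj.obj V :=
  (α.hom.app V).hom

variable {X Y} in
theorem evalAt_diagValue (α : param X (std k d) ⟶ Y) {V : DivPow k d} (t : TPow k d V.carrier)
    (ξ : tensorPower.{w, u} k d ⟶ X) : evalAt Y V t (diagValue X Y α ξ) =
      paramApp α V (X.obj.map (diagStd k d ≫ ihomHom (𝟙 (std k d)) (ofStd V t))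
        (evalBasis X ξ)) := by
  rw [diagValue_apply, evalAt_ofValue, ← param_naturality_apply, ← map_comp_apply]
  rfl

variable {X Y} in
theorem contract_coordFamily_diagValue (α : param X (std k d) ⟶ Y) {V : DivPow k d}
    (x : X.obj.obj (ihom (std k d) V))
    (z : TPow k d V.carrier ⊗[k] TPow k d (Module.Dual k V.carrier)) :
    contract (coordFamily (diagValue X Y α) x) V z = paramApp α V (act X _ _ (restrictHom V
      (TensorProduct.lift (tmap₂ (rankOne V.carrier V.carrier)) z)) x) := by
  induction z with
  | zero => simp only [map_zero, LinearMap.zero_apply]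
  | add x y hx hy => simp only [map_add, LinearMap.add_apply, hx, hy]
  | tmul t a =>
    rw [contract_tmul, coordFamily_apply, evalAt_diagValue, evalBasis_ofValue, ← map_comp_apply,
      ← map_comp_apply, ← Category.assoc, toStd_comp_weightIdem,
      evalBasisDual_comp_diagStd_comp_ofStd]
    rfl

theorem undiag_diagValue (α : param X (std k d) ⟶ Y) :
    undiag (diagValue X Y α) = homMap (𝟙 X) (𝟙 Y) (weightIdem k d) α := by
  ext V x
  refine (contract_coordFamily_diagValue α x (coev V)).trans ?_
  rw [lift_rankOne_coev, restrictHom_id]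
  rfl

/-- Needed because `homEvalBasis` after `homOfValue` is only the idempotent. The diagonal moves the
idempotent to the source, where it fixes values of elements of Sch(X). -/
theorem diagValue_homMap_weightIdem (α : param X (std k d) ⟶ Y) :
    diagValue X Y (homMap (𝟙 X) (𝟙 Y) (weightIdem k d) α) = diagValue X Y α := by
  refine LinearMap.ext fun ξ => ?_
  rw [diagValue_apply, diagValue_apply, homMap_app_apply, ← map_comp_apply,
    diagStd_comp_ihomHom_weightIdem, map_comp_apply, map_weightIdem_evalBasis]
  rfl

/-- The map `Sch(ℍ(X, Y)) → Hom(Sch(X), Sch(Y))`. -/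
def schHomEquiv : (tensorPower.{w, u} k d ⟶ internalHomObj X Y) ≃ₗ[k]
    ((tensorPower.{w, u} k d ⟶ X) →ₗ[k] (tensorPower.{w, u} k d ⟶ Y)) where
  __ := diagValue X Y ∘ₗ homEvalBasis X Y
  invFun φ := homOfValue X Y (undiag φ)
  left_inv γ := by
    change homOfValue X Y (undiag (diagValue X Y (homEvalBasis X Y γ))) = γ
    rw [undiag_diagValue, homOfValue_homMap_weightIdem, homOfValue_homEvalBasis]
  right_inv φ := by
    change diagValue X Y (homEvalBasis X Y (homOfValue X Y (undiag φ))) = φ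
    rw [homEvalBasis_homOfValue, diagValue_homMap_weightIdem, diagValue_undiag]

theorem schHomEquiv_apply (γ : tensorPower.{w, u} k d ⟶ internalHomObj X Y) :
    schHomEquiv X Y γ = diagValue X Y (homEvalBasis X Y γ) := rfl

theorem schHomEquiv_schRep (σ : Equiv.Perm (Fin d))
    (γ : tensorPower.{w, u} k d ⟶ internalHomObj X Y) :
    schHomEquiv X Y (schRep _ σ γ) = (schRep X).linHom (schRep Y) σ (schHomEquiv X Y γ) := by
  refine LinearMap.ext fun ξ => ?_
  rw [schHomEquiv_apply, schHomEquiv_apply, homEvalBasis_schRep, Representation.linHom_apply,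
    LinearMap.comp_apply, LinearMap.comp_apply, diagValue_apply, diagValue_apply, homMap_app_apply,
    ← ofValue_map_permStd, ← param_naturality_apply, evalBasis_schRep, ← map_comp_apply,
    ← map_comp_apply, ← map_comp_apply, diagStd_comp_ihomHom_permStd]
  rfl

theorem schHomEquiv_comp {P Q : (StrictPoly.{w, u} k d)ᵒᵖ × StrictPoly.{w, u} k d} (f : P ⟶ Q)
    (γ : tensorPower.{w, u} k d ⟶ internalHomObj P.1.unop P.2)
    (ξ : tensorPower.{w, u} k d ⟶ Q.1.unop) :
    schHomEquiv Q.1.unop Q.2 (γ ≫ homNat f) ξ =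
      schHomEquiv P.1.unop P.2 γ (ξ ≫ f.1.unop) ≫ f.2 := by
  rw [schHomEquiv_apply, schHomEquiv_apply, homEvalBasis_comp, diagValue_apply, diagValue_apply,
    homMap_app_apply, ihomHom_id, Q.1.unop.obj.map_id, evalBasis_comp, ← ofValue_app,
    ← naturality_apply]
  rfl

end Hom

/-- The Schur functor takes the internal Hom to the Hom of representations. -/
def schHomIso (k : Type u) [CommRing k] (d : ℕ) :
    internalHom.{w, u} k d ⋙ Sch.{w, u} k d ≅
      (Sch.{w, u} k d).op.prod (Sch.{w, u} k d) ⋙ kronHom.{w, u} k (Equiv.Perm (Fin d)) :=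
  NatIso.ofComponents
    (fun P => Rep.mkIso (.mk (schHomEquiv P.1.unop P.2)
      (fun σ => LinearMap.ext fun γ => schHomEquiv_schRep P.1.unop P.2 σ γ)))
    (fun {P Q} f => by
      ext1
      ext1
      refine LinearMap.ext fun γ => LinearMap.ext fun ξ => ?_
      exact schHomEquiv_comp f γ ξ)

end StrictPoly

end SPF

end

theorem theorem3p2 (k : Type u) [CommRing k] (d : ℕ) :
    Nonempty (SPF.StrictPoly.internalTensor.{w, u} k d ⋙ SPF.StrictPoly.Sch.{w, u} k d ≅
      (SPF.StrictPoly.Sch.{w, u} k d).prod (SPF.StrictPoly.Sch.{w, u} k d) ⋙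
        SPF.kron.{w, u} k (Equiv.Perm (Fin d))) ∧
    Nonempty (SPF.StrictPoly.internalHom.{w, u} k d ⋙ SPF.StrictPoly.Sch.{w, u} k d ≅
      (SPF.StrictPoly.Sch.{w, u} k d).op.prod (SPF.StrictPoly.Sch.{w, u} k d) ⋙
        SPF.kronHom.{w, u} k (Equiv.Perm (Fin d))) :=
  ⟨⟨(SPF.StrictPoly.schTensorIso k d).symm⟩, ⟨SPF.StrictPoly.schHomIso k d⟩⟩
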